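/- Let $\Sigma$ be an alphabet with $q\ge 2$ symbols. Let $\mathcal F=\{a_1,\dots,a_s\}$ be a finite collection of (forbidden) words over $\Sigma$, each of length at least $2$, and let $\Sigma_{\mathcal F}\subseteq\Sigma^{\mathbb N}$ be the set of one-sided sequences containing no word of $\mathcal F$ as a block (subword). A word is *allowed* if it is a block of some sequence in $\Sigma_{\mathcal F}$; $\mathcal L_n$ is the set of allowed words of length $n$. Assume that every symbol of $\Sigma$ is allowed. Let $\mathcal R=\{r_1,\dots,r_\ell\}$ be a finite collection of allowed (repeated) words with integer multiplicities $m_1,\dots,m_\ell\ge 2$. ($\mathcal F$ or $\mathcal R$ may be empty.) Assume that $\mathcal F\cup\mathcal R$ is reduced, i.e. none of the words $r_1,\dots,r_\ell,a_1,\dots,a_s$ is a subword of another one, and that the length $p$ of the longest word in $\mathcal F\cup\mathcal R$ is at least $2$. For a word $w$ put $m(w)=\prod_{i=1}^{\ell} m_i^{n(w;r_i)}$ if $w$ is allowed, where $n(w;r_i)$ is the number of occurrences of $r_i$ as a subword of $w$, and $m(w)=0$ otherwise. For $v=v_1\cdots v_n$ allowed put $k(v)=m(v)/m(v_2\cdots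 v_n)$. The adjacency matrix $A$ associated with $\mathcal F$ and $\mathcal R$ is indexed by $\mathcal L_{p-1}$: for $X=x_1\cdots x_{p-1}$, $Y=y_1\cdots y_{p-1}$, $A_{XY}=k(x_1\cdots x_{p-1}y_{p-1})$ if $x_2\cdots x_{p-1}=y_1\cdots y_{p-2}$ and $x_1\cdots x_{p-1}y_{p-1}\in\mathcal L_p$, and $A_{XY}=0$ otherwise. Assume that $A$ is irreducible. Let $f(0)=1$, $f(n)=\sum_{w\in\mathcal L_n}m(w)$ for $n\ge1$, and $F(z)=\sum_{n\ge 0}f(n)z^{-n}$. For words $u,v$ the correlation polynomial is $(u,v)_z=\sum_{i=1}^{|u|}c_iz^{|u|-i}$, where $c_i=1$ if, when $v$ is placed below $u$ with its first symbol under the $i$-th symbol of $u$, the overlapping segments of $u$ and $v$ are identical, and $c_i=0$ otherwise. Write $w_i=r_i$ for $1\le i\le \ell$ and $w_{\ell+j}=a_j$ for $1\le j\le s$. Let $D(z)$ be the diagonal matrix with $D_{ii}=z(1-\frac1{m_i})$ for $i\le\ell$ and $D_{ii}=-z$ for $\ell<i\le \ell+s$. Let $P(z)$ be the $(\ell+s)\times(\ell+s)$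 matrix with $$P(z)_{ij}=D_{jj}(z)\,(w_j,w_i)_z-\varepsilon_{ij}z^{|w_i|},$$ where $\varepsilon_{ij}=1$ if $i=j\le \ell$ and $\varepsilon_{ij}=0$ otherwise, and let $Q=D^{-1}P^{T}D$. Let $R_i(z)$ and $S_i(z)$ be the $i$-th row sums of the inverses $P(z)^{-1}$ and $Q(z)^{-1}$ over the field of rational functions. Theorem. As rational functions, $$z-q+z\sum_{i=1}^{\ell}\Bigl(1-\frac1{m_i}\Bigr)R_i(z)-z\sum_{j=1}^{s}R_{\ell+j}(z)\;=\;z-q+z\sum_{i=1}^{\ell}\Bigl(1-\frac1{m_i}\Bigr)S_i(z)-z\sum_{j=1}^{s}S_{\ell+j}(z).$$ Moreover $A$ has a Perron root $\theta$ (a real eigenvalue such that $|\mu|\le\theta$ for every complex eigenvalue $\mu$ of $A$), and $\theta$ is the largest real zero of this rational function. Furthermore, for all complex $z$ of sufficiently large modulus the series $F(z)$ converges and agrees with a rational function of $z$, and $\theta$ is also the largest real pole of that rational function. -/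

import Mathlib

namespace RepeatedWords

/-- A list `forb` of forbidden words `a₁, …, a_s` and a list `rep` of repeated words
`r₁, …, r_ℓ` with multiplicities `m₁, …, m_ℓ`, over the alphabet `α`. -/
structure Collections (α : Type*) (ℓ s : ℕ) where
  forb : Fin s → List α
  rep : Fin ℓ → List α
  mult : Fin ℓ → ℕ

variable {α : Type*} {ℓ s : ℕ}

/-- The block `x_k x_{k+1} … x_{k+n-1}` of the sequence `x`. -/
def block (x : ℕ → α) (k n : ℕ) : List α :=
  (List.range n).map fun t => x (k + t)

namespace Collections

/-- The words of both collections: first `r₁, …, r_ℓ`, then `a₁, …, a_s`. -/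
def word (W : Collections α ℓ s) : Fin ℓ ⊕ Fin s → List α :=
  Sum.elim W.rep W.forb

/-- The union of the two collections is reduced: no word is a subword of another one. -/
def IsReduced (W : Collections α ℓ s) : Prop :=
  ∀ i j, i ≠ j → ¬ W.word i <:+: W.word j

/-- The length `p` of the longest word in the two collections. -/
def maxLength (W : Collections α ℓ s) : ℕ :=
  Finset.univ.sup fun i => (W.word i).length

/-- The one-sided subshift of finite type: no forbidden word occurs as a block. -/
def shift (W : Collections α ℓ s) : Set (ℕ → α) :=
  {x | ∀ j k, block x k (W.forb j).length ≠ W.forb j}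

/-- A word is allowed if it occurs as a block of some sequence of the subshift. -/
def Allowed (W : Collections α ℓ s) (w : List α) : Prop :=
  ∃ x ∈ W.shift, ∃ k, block x k w.length = w

/-- The allowed words of length `n`. -/
def language (W : Collections α ℓ s) (n : ℕ) : Set (List α) :=
  {w | w.length = n ∧ W.Allowed w}

noncomputable instance [Fintype α] (W : Collections α ℓ s) (n : ℕ) :
    Fintype (W.language n) :=
  ((List.finite_length_eq α n).subset fun _ h => h.1).fintype

end Collections

/-- The number of occurrences of `r` as a subword of `w` (for nonempty `r`). -/
def occurrences [DecidableEq α] (w r : List α) : ℕ :=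
  ((Finset.range w.length).filter fun k => r <+: w.drop k).card

/-- For `X = x₁ … x_m` and `Y = y₁ … y_m` the word `x₁ … x_m y_m`. -/
def wordStar (X Y : List α) : List α :=
  X ++ Y.getLast?.toList

/-- `X * Y` is defined: `x₂ … x_m = y₁ … y_{m-1}`. -/
def StarDefined (X Y : List α) : Prop :=
  X.tail = Y.dropLast

open Polynomial in
/-- The correlation polynomial `(u, v)_z`: place `v` below `u`, with its first symbol under the
symbol of `u` at (zero-based) position `k`; if the overlapping segments agree, there is a term
of degree `|u| - 1 - k`. -/
noncomputable def corrPoly [DecidableEq α] (u v : List α) : ℝ[X] :=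
  ∑ k ∈ Finset.range u.length,
    if (u.drop k).take v.length = v.take (u.drop k).length then X ^ (u.length - 1 - k) else 0

namespace Collections

section Decidable

variable [DecidableEq α]

open Classical in
/-- The multiplicity `m(w)` of a word. -/
noncomputable def multiplicity (W : Collections α ℓ s) (w : List α) : ℕ :=
  if W.Allowed w then ∏ i, W.mult i ^ occurrences w (W.rep i) else 0

/-- `k(v) = m(v) / m(v₂ … v_n)`. -/
noncomputable def ratio (W : Collections α ℓ s) (v : List α) : ℝ :=
  (W.multiplicity v : ℝ) / (W.multiplicity v.tail : ℝ)

open Classical in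
/-- The adjacency matrix, indexed by the allowed words of length `p - 1`. -/
noncomputable def adjMatrix (W : Collections α ℓ s) :
    Matrix (W.language (W.maxLength - 1)) (W.language (W.maxLength - 1)) ℝ :=
  Matrix.of fun X Y =>
    if StarDefined X.1 Y.1 ∧ wordStar X.1 Y.1 ∈ W.language W.maxLength
    then W.ratio (wordStar X.1 Y.1) else 0

/-- `f(n)`, the number of allowed words of length `n` counted with multiplicity; `f(0) = 1`. -/
noncomputable def count [Fintype α] (W : Collections α ℓ s) (n : ℕ) : ℕ :=
  if n = 0 then 1 else ∑ w : W.language n, W.multiplicity w.1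

/-- The matrix function `P(z)`. -/
noncomputable def matrixP (W : Collections α ℓ s) :
    Matrix (Fin ℓ ⊕ Fin s) (Fin ℓ ⊕ Fin s) (RatFunc ℝ) :=
  Matrix.fromBlocks
    (Matrix.of fun i j =>
      RatFunc.X * RatFunc.C (1 - 1 / (W.mult j : ℝ)) *
          algebraMap _ (RatFunc ℝ) (corrPoly (W.rep j) (W.rep i)) -
        if i = j then RatFunc.X ^ (W.rep j).length else 0)
    (Matrix.of fun i j =>
      -(RatFunc.X * algebraMap _ (RatFunc ℝ) (corrPoly (W.forb j) (W.rep i))))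
    (Matrix.of fun i j =>
      RatFunc.X * RatFunc.C (1 - 1 / (W.mult j : ℝ)) *
        algebraMap _ (RatFunc ℝ) (corrPoly (W.rep j) (W.forb i)))
    (Matrix.of fun i j =>
      -(RatFunc.X * algebraMap _ (RatFunc ℝ) (corrPoly (W.forb j) (W.forb i))))

/-- The diagonal matrix function `D(z)`. -/
noncomputable def matrixD (W : Collections α ℓ s) :
    Matrix (Fin ℓ ⊕ Fin s) (Fin ℓ ⊕ Fin s) (RatFunc ℝ) :=
  Matrix.diagonal <| Sum.elim
    (fun i => RatFunc.X * RatFunc.C (1 - 1 / (W.mult i : ℝ))) (fun _ => -RatFunc.X)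

/-- The matrix function `Q = D⁻¹ Pᵀ D`. -/
noncomputable def matrixQ (W : Collections α ℓ s) :
    Matrix (Fin ℓ ⊕ Fin s) (Fin ℓ ⊕ Fin s) (RatFunc ℝ) :=
  W.matrixD⁻¹ * W.matrixP.transpose * W.matrixD

/-- The rational functions `R_i(z)`: row sums of `P(z)⁻¹`. -/
noncomputable def rowSumP (W : Collections α ℓ s) (i : Fin ℓ ⊕ Fin s) : RatFunc ℝ :=
  ∑ j, W.matrixP⁻¹ i j

/-- The rational functions `S_i(z)`: row sums of `Q(z)⁻¹`. -/
noncomputable def rowSumQ (W : Collections α ℓ s) (i : Fin ℓ ⊕ Fin s) : RatFunc ℝ :=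
  ∑ j, W.matrixQ⁻¹ i j

end Decidable

/-- `z - q + z ∑_{i ≤ ℓ} (1 - 1/m_i) T_i(z) - z ∑_{j ≤ s} T_{ℓ+j}(z)`, where `q = |α|`. -/
noncomputable def combination [Fintype α] (W : Collections α ℓ s)
    (T : Fin ℓ ⊕ Fin s → RatFunc ℝ) : RatFunc ℝ :=
  RatFunc.X - RatFunc.C (Fintype.card α : ℝ)
    + RatFunc.X * ∑ i : Fin ℓ, RatFunc.C (1 - 1 / (W.mult i : ℝ)) * T (Sum.inl i)
    - RatFunc.X * ∑ j : Fin s, T (Sum.inr j)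

end Collections

/-- The real zeros of a rational function (numerator in lowest terms vanishes). -/
def realZeros (G : RatFunc ℝ) : Set ℝ := {x | G.num.eval x = 0}

/-- The real poles of a rational function (denominator in lowest terms vanishes). -/
def realPoles (G : RatFunc ℝ) : Set ℝ := {x | G.denom.eval x = 0}

/-- `G` is the rational function given by `∑ f(n) z⁻ⁿ`: for all complex `z` of sufficiently
large modulus, the series converges to `G(z)`. -/
def IsGeneratingFunction (f : ℕ → ℕ) (G : RatFunc ℝ) : Prop :=
  ∀ᶠ z : ℂ in Bornology.cobounded ℂ,
    HasSum (fun n => (f n : ℂ) * (z⁻¹) ^ n) (G.eval (algebraMap ℝ ℂ) z)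

/-- `θ` is the Perron root of the real matrix `A`: it is an eigenvalue and it is largest among all
complex eigenvalues, in modulus. -/
def IsPerronRoot {ι : Type*} [Fintype ι] [DecidableEq ι] (A : Matrix ι ι ℝ) (θ : ℝ) : Prop :=
  Module.End.HasEigenvalue (Matrix.toLin' A) θ ∧
    ∀ μ : ℂ, Module.End.HasEigenvalue (Matrix.toLin' (A.map (algebraMap ℝ ℂ))) μ → ‖μ‖ ≤ θ

end RepeatedWords

open RepeatedWords

/-!
Give every word over the alphabet a weight: the product of the multiplicities of its occurrences of
repeated words, or `0` if it contains a forbidden word. As the collections are reduced, at most one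
of their words ends at a given position, so appending a letter multiplies the weight by a single
factor. Expanding this along an appended word `w_i` yields a linear system, with matrix `P(z)` up to
a rescaling of the columns, for the generating functions of the weighted words that end with the
`w_j`. By Cramer's rule, the generating function of all weighted words is `z` divided by the
combination of the row sums of `P(z)⁻¹`. Up to its term `z - q`, this combination is the sum of all
entries of `D P⁻¹`, and `D Q⁻¹` is the transpose of `D P⁻¹`, so `Q` gives the same combination.

The transfer matrix expresses `f(n + p - 1)` as the sum of the entries of `Aⁿ m` with a positive
vector `m`. Hence the nonnegative series `∑ f(n) x⁻ⁿ` converges for `x` larger than the spectral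
radius `θ` of `A`, whereas `f(n) ≥ κ θⁿ` makes it diverge at `θ`. Since the series is a rational
function, `θ` is its largest real pole and, by the same argument for the characteristic polynomial,
an eigenvalue of `A`. A word that avoids the forbidden words may fail to be allowed, but by
compactness it then cannot be extended to the right by more than a bounded number of letters without
meeting a forbidden word. So the generating function of all weighted words blows up at the same `θ`,
which is therefore the largest real zero of its reciprocal up to the factor `z`, the combination
above.
-/

namespace RepeatedWords

universe u

open Polynomial

/-! ### Series in `1 / x` -/

section Series

open Filter Topology

theorem eventually_nhdsGT_of_cofinite {P : ℝ → Prop} {θ x₀ : ℝ}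
    (hP : ∀ᶠ x in cofinite, θ < x → P x) (hx₀ : θ ≤ x₀) : ∀ᶠ x in 𝓝[>] x₀, P x := by
  have hle : 𝓝[>] x₀ ≤ 𝓝[≠] x₀ := nhdsWithin_mono x₀ fun x hx => ne_of_gt hx
  filter_upwards [hP.filter_mono (hle.trans (nhdsNE_le_cofinite x₀)), self_mem_nhdsWithin]
    with x hx hxx
  exact hx (hx₀.trans_lt hxx)

theorem tendsto_eval_nhdsGT (p : ℝ[X]) (x : ℝ) :
    Tendsto (fun y => p.eval y) (𝓝[>] x) (𝓝 (p.eval x)) :=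
  p.continuous.continuousAt.tendsto.mono_left nhdsWithin_le_nhds

theorem eval_denom_ne_zero {G : RatFunc ℝ} {x : ℝ} (h : G.num.eval x = 0) :
    G.denom.eval x ≠ 0 := fun h' => by
  obtain ⟨a, b, hab⟩ := G.isCoprime_num_denom
  simpa [h, h'] using congrArg (Polynomial.eval x) hab

theorem eventually_eval_ne_zero {R : Type*} [CommRing R] [IsDomain R] {p : R[X]} (hp : p ≠ 0) :
    ∀ᶠ x in cofinite, p.eval x ≠ 0 :=
  eventually_cofinite.2 <| by simpa using Polynomial.finite_setOfPred_isRoot hp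

theorem eval_mul_eval_denom {G : RatFunc ℝ} {x : ℝ} (hx : G.denom.eval x ≠ 0) :
    G.eval (RingHom.id ℝ) x * G.denom.eval x = G.num.eval x := by
  simp only [RatFunc.eval, eval₂_id]
  exact div_mul_cancel₀ _ hx

/-- The sum `∑ cₙ x⁻ⁿ` of a power series in `1 / x`; it is `0` where the series diverges. -/
noncomputable def invSeries (c : ℕ → ℝ) (x : ℝ) : ℝ := ∑' n, c n * (x⁻¹) ^ n

/-- The sequence `c` is nonnegative and has exponential growth rate `θ > 0`, with no smaller-order
loss from below. The upper bound is encoded by convergence of `∑ cₙ x⁻ⁿ` for `x > θ`, so that it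
allows polynomial factors. -/
structure HasGrowth (c : ℕ → ℝ) (θ : ℝ) : Prop where
  pos : 0 < θ
  nonneg : ∀ n, 0 ≤ c n
  summable : ∀ x, θ < x → Summable fun n => c n * (x⁻¹) ^ n
  lower : ∃ κ : ℝ, 0 < κ ∧ ∃ N : ℕ, ∀ n, N ≤ n → κ * θ ^ n ≤ c n

namespace HasGrowth

variable {c d : ℕ → ℝ} {θ : ℝ} {a b : ℝ[X]}

theorem term_nonneg (h : HasGrowth c θ) {x : ℝ} (hx : 0 < x) (n : ℕ) :
    0 ≤ c n * (x⁻¹) ^ n :=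
  mul_nonneg (h.nonneg n) (pow_nonneg (inv_nonneg.2 hx.le) n)

theorem hasSum_invSeries (h : HasGrowth c θ) {x : ℝ} (hx : θ < x) :
    HasSum (fun n => c n * (x⁻¹) ^ n) (invSeries c x) :=
  (h.summable x hx).hasSum

theorem summable_complex (h : HasGrowth c θ) {z : ℂ} (hz : θ < ‖z‖) :
    Summable fun n => (c n : ℂ) * (z⁻¹) ^ n := by
  refine Summable.of_norm ((h.summable ‖z‖ hz).congr fun n => ?_)
  rw [norm_mul, norm_pow, norm_inv, Complex.norm_of_nonneg (h.nonneg n)]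

theorem of_shift (hc : ∀ n, 0 ≤ c n) {k : ℕ} (h : HasGrowth (fun n => c (n + k)) θ) :
    HasGrowth c θ where
  pos := h.pos
  nonneg := hc
  summable x hx := by
    refine (summable_nat_add_iff k).1 (((h.summable x hx).mul_right (x⁻¹ ^ k)).congr fun n => ?_)
    rw [pow_add, mul_assoc]
  lower := by
    obtain ⟨κ, hκ, N, hN⟩ := h.lower
    have hθ := h.pos
    refine ⟨κ / θ ^ k, by positivity, N + k, fun n hn => ?_⟩
    obtain ⟨m, rfl⟩ := Nat.exists_eq_add_of_le' (le_of_add_le_right hn)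
    calc κ / θ ^ k * θ ^ (m + k) = κ * θ ^ m := by rw [pow_add]; field_simp
      _ ≤ c (m + k) := hN m (by omega)

theorem of_le_of_shift_le (h : HasGrowth c θ) (hcd : ∀ n, c n ≤ d n) {k N : ℕ} {K : ℝ}
    (hd : ∀ n, k ≤ n → d (n + N) ≤ K * c n) : HasGrowth d θ where
  pos := h.pos
  nonneg n := (h.nonneg n).trans (hcd n)
  summable x hx := by
    have hx0 := h.pos.trans hx
    rw [← summable_nat_add_iff (k + N)]
    refine Summable.of_nonneg_of_le
      (fun n => mul_nonneg ((h.nonneg _).trans (hcd _)) (by positivity)) (fun n => ?_)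
      (((summable_nat_add_iff k).2 (h.summable x hx)).mul_left (K * x⁻¹ ^ N))
    calc d (n + (k + N)) * x⁻¹ ^ (n + (k + N)) ≤ K * c (n + k) * x⁻¹ ^ (n + (k + N)) := by
          rw [← add_assoc]; gcongr; exact hd _ (Nat.le_add_left _ _)
      _ = K * x⁻¹ ^ N * (c (n + k) * x⁻¹ ^ (n + k)) := by rw [← add_assoc, pow_add _ (n + k)]; ring
  lower := by
    obtain ⟨κ, hκ, N, hN⟩ := h.lower
    exact ⟨κ, hκ, N, fun n hn => (hN n hn).trans (hcd n)⟩

theorem invSeries_nonneg (h : HasGrowth c θ) {x : ℝ} (hx : 0 < x) : 0 ≤ invSeries c x :=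
  tsum_nonneg fun n => h.term_nonneg hx n

theorem invSeries_anti (h : HasGrowth c θ) {x y : ℝ} (hx : θ < x) (hxy : x ≤ y) :
    invSeries c y ≤ invSeries c x := by
  have hx0 := h.pos.trans hx
  refine (h.summable y (hx.trans_le hxy)).tsum_le_tsum (fun n => ?_) (h.summable x hx)
  exact mul_le_mul_of_nonneg_left
    (pow_le_pow_left₀ (inv_nonneg.2 (hx0.trans_le hxy).le) (inv_anti₀ hx0 hxy) n) (h.nonneg n)

theorem tendsto_invSeries (h : HasGrowth c θ) : Tendsto (invSeries c) (𝓝[>] θ) atTop := by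
  obtain ⟨κ, hκ, N, hN⟩ := h.lower
  refine tendsto_atTop.2 fun K => ?_
  obtain ⟨M, hM⟩ := exists_nat_gt (K / κ)
  have hcont : ContinuousAt (fun x : ℝ => ∑ n ∈ Finset.Ico N (N + M), c n * (x⁻¹) ^ n) θ := by
    have h0 := h.pos.ne'
    fun_prop (disch := assumption)
  have hval : K < ∑ n ∈ Finset.Ico N (N + M), c n * (θ⁻¹) ^ n := by
    calc K < M * κ := (div_lt_iff₀ hκ).1 hM
      _ = ∑ _ ∈ Finset.Ico N (N + M), κ := by simp
      _ ≤ _ := Finset.sum_le_sum fun n hn => ?_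
    rw [inv_pow, ← div_eq_mul_inv, le_div_iff₀ (pow_pos h.pos n)]
    exact hN n (Finset.mem_Ico.1 hn).1
  filter_upwards [(hcont.eventually (lt_mem_nhds hval)).filter_mono nhdsWithin_le_nhds,
    self_mem_nhdsWithin] with x hx hxθ
  exact hx.le.trans ((h.summable x hxθ).sum_le_tsum _
    fun n _ => h.term_nonneg (h.pos.trans hxθ) n)

/-- The series blows up at `θ`, while the polynomials stay bounded. -/
theorem eval_eq_zero (h : HasGrowth c θ)
    (hab : ∀ᶠ x in cofinite, θ < x → invSeries c x * a.eval x = b.eval x) : a.eval θ = 0 := by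
  have hlim : Tendsto (fun x => b.eval x * (invSeries c x)⁻¹) (𝓝[>] θ) (𝓝 0) := by
    simpa using (tendsto_eval_nhdsGT b θ).mul h.tendsto_invSeries.inv_tendsto_atTop
  refine tendsto_nhds_unique (tendsto_eval_nhdsGT a θ) (hlim.congr' ?_)
  filter_upwards [eventually_nhdsGT_of_cofinite hab le_rfl,
    h.tendsto_invSeries.eventually_gt_atTop 0] with x hx hx0
  rw [← hx]
  field_simp

/-- The series is bounded near every point to the right of `θ`, so a zero of `a` there forces a
zero of `b`. -/
theorem eval_eq_zero_of_eval_eq_zero (h : HasGrowth c θ)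
    (hab : ∀ᶠ x in cofinite, θ < x → invSeries c x * a.eval x = b.eval x) {x₀ : ℝ}
    (hx₀ : θ < x₀) (ha : a.eval x₀ = 0) : b.eval x₀ = 0 := by
  obtain ⟨x₁, hx₁, hx₁₀⟩ := exists_between hx₀
  have hbound : Tendsto (fun x => invSeries c x₁ * |a.eval x|) (𝓝[>] x₀) (𝓝 0) := by
    simpa [ha] using (tendsto_eval_nhdsGT a x₀).abs.const_mul (invSeries c x₁)
  refine tendsto_nhds_unique (tendsto_eval_nhdsGT b x₀) (squeeze_zero_norm' ?_ hbound)
  filter_upwards [eventually_nhdsGT_of_cofinite hab hx₀.le, self_mem_nhdsWithin] with x hx hxx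
  have hxx : x₀ < x := hxx
  rw [← hx, Real.norm_eq_abs, abs_mul,
    abs_of_nonneg (h.invSeries_nonneg (h.pos.trans (hx₀.trans hxx)))]
  exact mul_le_mul_of_nonneg_right (h.invSeries_anti hx₁ (hx₁₀.trans hxx).le) (abs_nonneg _)

theorem isGreatest_realPoles (h : HasGrowth c θ) {G : RatFunc ℝ}
    (hG : ∀ᶠ x in cofinite, θ < x → G.eval (RingHom.id ℝ) x = invSeries c x) :
    IsGreatest (realPoles G) θ := by
  have hquot : ∀ᶠ x in cofinite, θ < x → invSeries c x * G.denom.eval x = G.num.eval x := by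
    filter_upwards [hG, eventually_eval_ne_zero G.denom_ne_zero] with x hx hx0 hθ
    rw [← hx hθ, eval_mul_eval_denom hx0]
  refine ⟨h.eval_eq_zero hquot, fun x hx => not_lt.1 fun hlt => ?_⟩
  exact eval_denom_ne_zero (h.eval_eq_zero_of_eval_eq_zero hquot hlt hx) hx

theorem isGreatest_realZeros (h : HasGrowth c θ) {G : RatFunc ℝ}
    (hG : ∀ᶠ x in cofinite, θ < x → invSeries c x * G.eval (RingHom.id ℝ) x = x) :
    IsGreatest (realZeros G) θ := by
  have hquot : ∀ᶠ x in cofinite, θ < x → invSeries c x * G.num.eval x = (X * G.denom).eval x := by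
    filter_upwards [hG, eventually_eval_ne_zero G.denom_ne_zero] with x hx hx0 hθ
    rw [← eval_mul_eval_denom hx0, ← mul_assoc, hx hθ, eval_mul, eval_X]
  refine ⟨h.eval_eq_zero hquot, fun x hx => not_lt.1 fun hlt => ?_⟩
  have hzero := h.eval_eq_zero_of_eval_eq_zero hquot hlt hx
  rw [eval_mul, eval_X] at hzero
  exact mul_ne_zero (h.pos.trans hlt).ne' (eval_denom_ne_zero hx) hzero

end HasGrowth

theorem hasSum_shift {K : Type*} [Field K] [TopologicalSpace K] [IsTopologicalRing K]
    {c : ℕ → K} {z S : K} (hz : z ≠ 0) (hc : HasSum (fun n => c n * (z⁻¹) ^ n) S) (k : ℕ) :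
    HasSum (fun n => c (n + k) * (z⁻¹) ^ n)
      (z ^ k * S - ∑ n ∈ Finset.range k, c n * z ^ (k - n)) := by
  have hpow : ∀ n ∈ Finset.range k, z ^ k * (c n * (z⁻¹) ^ n) = c n * z ^ (k - n) := by
    intro n hn
    rw [pow_sub₀ z hz (Finset.mem_range.1 hn).le, inv_pow]
    ring
  rw [← Finset.sum_congr rfl hpow, ← Finset.mul_sum, ← mul_sub]
  refine (((hasSum_nat_add_iff' k).2 hc).mul_left (z ^ k)).congr_fun fun n => ?_
  rw [pow_add, mul_left_comm, mul_left_comm (z ^ k), inv_pow z k,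
    mul_inv_cancel₀ (pow_ne_zero k hz), mul_one]

end Series

/-! ### Linear recurrences -/

section Recurrence

open Filter

/-- The sequence `c` satisfies the linear recurrence `∑ₖ pₖ c (n + k) = 0` with characteristic
polynomial `p`. -/
def SatisfiesRecurrence {R : Type*} [Semiring R] (c : ℕ → R) (p : R[X]) : Prop :=
  ∀ n, p.sum (fun k a => a * c (n + k)) = 0

theorem SatisfiesRecurrence.mul_X_pow {R : Type*} [Semiring R] {c : ℕ → R} {p : R[X]} {N : ℕ}
    (h : SatisfiesRecurrence (fun n => c (n + N)) p) : SatisfiesRecurrence c (p * X ^ N) := by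
  have hshift : ∀ (d : ℕ → R) (q : R[X]),
      (q * X ^ N).sum (fun k a => a * d k) = q.sum fun k a => a * d (k + N) := by
    intro d q
    induction q using Polynomial.induction_on' with
    | add q r hq hr => rw [add_mul, sum_add_index, sum_add_index, hq, hr] <;> simp [add_mul]
    | monomial n a => simp [monomial_mul_X_pow, sum_monomial_index]
  intro n
  rw [hshift fun k => c (n + k)]
  simpa only [add_assoc] using h n

/-- The polynomial `p(z) ∑ cₙ z⁻ⁿ`, for a sequence satisfying the recurrence with characteristic
polynomial `p`. -/
noncomputable def recurrenceNum (c : ℕ → ℝ) (p : ℝ[X]) : ℝ[X] :=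
  p.sum fun k a => C a * ∑ n ∈ Finset.range k, C (c n) * X ^ (k - n)

/-- The rational function represented by `∑ cₙ z⁻ⁿ`, for a sequence satisfying the recurrence with
characteristic polynomial `p`. -/
noncomputable def recurrenceRatFunc (c : ℕ → ℝ) (p : ℝ[X]) : RatFunc ℝ :=
  algebraMap ℝ[X] (RatFunc ℝ) (recurrenceNum c p) / algebraMap ℝ[X] (RatFunc ℝ) p

variable {K : Type} [Field K] [Algebra ℝ K] [TopologicalSpace K] [IsTopologicalRing K] [T2Space K]

theorem SatisfiesRecurrence.aeval_mul_eq {c : ℕ → ℝ} {p : ℝ[X]} (h : SatisfiesRecurrence c p)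
    {z S : K} (hz : z ≠ 0) (hS : HasSum (fun n => algebraMap ℝ K (c n) * (z⁻¹) ^ n) S) :
    S * aeval z p = aeval z (recurrenceNum c p) := by
  have hterms : HasSum (fun n => ∑ k ∈ p.support,
      algebraMap ℝ K (p.coeff k) * (algebraMap ℝ K (c (n + k)) * (z⁻¹) ^ n))
      (∑ k ∈ p.support, algebraMap ℝ K (p.coeff k) *
        (z ^ k * S - ∑ n ∈ Finset.range k, algebraMap ℝ K (c n) * z ^ (k - n))) :=
    hasSum_sum fun k _ => (hasSum_shift hz hS k).mul_left _
  have hzero : ∀ n, ∑ k ∈ p.support,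
      algebraMap ℝ K (p.coeff k) * (algebraMap ℝ K (c (n + k)) * (z⁻¹) ^ n) = 0 := by
    intro n
    have := congrArg (algebraMap ℝ K) (h n)
    rw [Polynomial.sum, map_sum, map_zero] at this
    simp only [← mul_assoc, ← Finset.sum_mul, ← map_mul, this, zero_mul]
  simp only [hzero] at hterms
  have hsum := hterms.unique hasSum_zero
  simp only [mul_sub, Finset.sum_sub_distrib, ← mul_assoc, ← Finset.sum_mul] at hsum
  rw [aeval_def, eval₂_eq_sum, Polynomial.sum, mul_comm, sub_eq_zero.1 hsum, recurrenceNum,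
    Polynomial.sum, map_sum]
  simp only [map_mul, map_sum, map_pow, aeval_C, aeval_X]

theorem eval_mul_eval₂_of_mul_eq {F L : Type u} [Field F] [Field L] (f : F →+* L) {z : L}
    {G : RatFunc F} {p q : F[X]}
    (hG : G * algebraMap F[X] (RatFunc F) q = algebraMap F[X] (RatFunc F) p)
    (hq : q.eval₂ f z ≠ 0) : G.eval f z * q.eval₂ f z = p.eval₂ f z := by
  have hq0 : q ≠ 0 := by rintro rfl; simp at hq
  have hGdiv : G = algebraMap F[X] (RatFunc F) p / algebraMap F[X] (RatFunc F) q :=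
    (eq_div_iff (RatFunc.algebraMap_ne_zero hq0)).2 hG
  have hdenom : eval₂ f z G.denom ≠ 0 := fun h0 =>
    hq (eval₂_eq_zero_of_dvd_of_eval₂_eq_zero f z (hGdiv ▸ RatFunc.denom_div_dvd p q) h0)
  have hnum : G.num * q = p * G.denom := (RatFunc.num_mul_eq_mul_denom_iff hq0).2 hGdiv
  rw [RatFunc.eval, div_mul_eq_mul_div, div_eq_iff hdenom, ← eval₂_mul, ← eval₂_mul, hnum]

theorem SatisfiesRecurrence.eval_recurrenceRatFunc {c : ℕ → ℝ} {p : ℝ[X]}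
    (h : SatisfiesRecurrence c p) {z S : K} (hz : z ≠ 0) (hp : aeval z p ≠ 0)
    (hS : HasSum (fun n => algebraMap ℝ K (c n) * (z⁻¹) ^ n) S) :
    (recurrenceRatFunc c p).eval (algebraMap ℝ K) z = S := by
  have hp0 : p ≠ 0 := by rintro rfl; simp at hp
  refine mul_right_cancel₀ hp ((eval_mul_eval₂_of_mul_eq _ ?_ hp).trans (h.aeval_mul_eq hz hS).symm)
  exact div_mul_cancel₀ _ (RatFunc.algebraMap_ne_zero hp0)

theorem SatisfiesRecurrence.isGeneratingFunction {c : ℕ → ℕ} {p : ℝ[X]} {θ : ℝ}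
    (h : SatisfiesRecurrence (fun n => (c n : ℝ)) p) (hp : p ≠ 0)
    (hc : HasGrowth (fun n => (c n : ℝ)) θ) :
    IsGeneratingFunction c (recurrenceRatFunc (fun n => (c n : ℝ)) p) := by
  have hroots : ∀ᶠ z : ℂ in cofinite, aeval z p ≠ 0 := by
    simpa only [eval_map_algebraMap] using
      eventually_eval_ne_zero (map_ne_zero (f := algebraMap ℝ ℂ) hp)
  filter_upwards [hroots.filter_mono (Bornology.le_cofinite ℂ),
    tendsto_norm_cobounded_atTop.eventually_gt_atTop θ] with z hz hθz
  have hsum := (hc.summable_complex hθz).hasSum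
  rw [h.eval_recurrenceRatFunc (norm_pos_iff.1 (hc.pos.trans hθz)) hz hsum]
  simpa only [Complex.ofReal_natCast] using hsum

theorem SatisfiesRecurrence.isGreatest_realPoles {c : ℕ → ℝ} {p : ℝ[X]} {θ : ℝ}
    (h : SatisfiesRecurrence c p) (hp : p ≠ 0) (hc : HasGrowth c θ) :
    IsGreatest (realPoles (recurrenceRatFunc c p)) θ := by
  refine hc.isGreatest_realPoles ?_
  filter_upwards [eventually_eval_ne_zero hp] with x hx hθx
  exact h.eval_recurrenceRatFunc (K := ℝ) (hc.pos.trans hθx).ne' hx (hc.hasSum_invSeries hθx)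

end Recurrence

/-! ### Spectral radius and growth of matrix powers -/

section Perron

open Filter Topology Matrix

theorem eventually_norm_pow_le {A : Type*} [NormedRing A] [NormedAlgebra ℂ A] [CompleteSpace A]
    {a : A} {r : ℝ} (ha : spectralRadius ℂ a < ENNReal.ofReal r) :
    ∀ᶠ n : ℕ in atTop, ‖a ^ n‖ ≤ r ^ n := by
  have hlim := spectrum.pow_norm_pow_one_div_tendsto_nhds_spectralRadius a
  filter_upwards [hlim.eventually_lt_const ha, eventually_ne_atTop 0] with n hn hn0
  have hroot : ‖a ^ n‖ ^ (1 / n : ℝ) < r :=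
    (ENNReal.ofReal_lt_ofReal_iff_of_nonneg (by positivity)).1 hn
  calc ‖a ^ n‖ = (‖a ^ n‖ ^ (1 / n : ℝ)) ^ n := by
        rw [one_div, Real.rpow_inv_natCast_pow (norm_nonneg _) hn0]
    _ ≤ r ^ n := by gcongr

variable {ι : Type*} [Fintype ι]

theorem mulVec_mono {A : Matrix ι ι ℝ} (hA : ∀ i j, 0 ≤ A i j) {x y : ι → ℝ} (h : x ≤ y) :
    A *ᵥ x ≤ A *ᵥ y :=
  fun i => Finset.sum_le_sum fun j _ => mul_le_mul_of_nonneg_left (h j) (hA i j)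

theorem exists_smul_le_of_pos {ι : Type*} [Finite ι] {v : ι → ℝ} (hv : ∀ i, 0 < v i) (m : ι → ℝ) :
    ∃ κ : ℝ, 0 < κ ∧ κ • m ≤ v := by
  have h : ∀ i, ∀ᶠ κ : ℝ in 𝓝[>] 0, κ * m i < v i := fun i => by
    have hlim : Tendsto (fun κ : ℝ => κ * m i) (𝓝[>] 0) (𝓝 (0 * m i)) :=
      (tendsto_id.mono_left nhdsWithin_le_nhds).mul_const _
    exact hlim.eventually_lt_const (by simpa using hv i)
  obtain ⟨κ, hκ, hκ0⟩ := ((eventually_all.2 h).and self_mem_nhdsWithin).exists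
  exact ⟨κ, hκ0, fun i => (hκ i).le⟩

variable [DecidableEq ι]

theorem hasEigenvalue_toLin'_iff {K : Type*} [Field K] {A : Matrix ι ι K} {μ : K} :
    Module.End.HasEigenvalue (toLin' A) μ ↔ μ ∈ spectrum K A := by
  rw [Module.End.hasEigenvalue_iff_mem_spectrum, spectrum_toLin']

theorem isNilpotent_of_spectrum_subset_zero {K : Type*} [Field K] [IsAlgClosed K]
    {A : Matrix ι ι K} (hA : spectrum K A ⊆ {0}) : IsNilpotent A := by
  have hroots : A.charpoly.roots = Multiset.replicate (Multiset.card A.charpoly.roots) 0 :=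
    Multiset.eq_replicate_card.2 fun r hr =>
      hA (mem_spectrum_iff_isRoot_charpoly.2 (isRoot_of_mem_roots hr))
  have hcharpoly : A.charpoly = X ^ Multiset.card A.charpoly.roots := by
    conv_lhs => rw [(IsAlgClosed.splits A.charpoly).eq_prod_roots_of_monic A.charpoly_monic, hroots]
    simp
  refine ⟨Multiset.card A.charpoly.roots, ?_⟩
  rw [← aeval_X_pow (R := K), ← hcharpoly, aeval_self_charpoly]

section Norm

attribute [local instance] Matrix.linftyOpNormedRing Matrix.linftyOpNormedAlgebra

theorem summable_pow_mulVec {A : Matrix ι ι ℝ} {θ : ℝ} (hθ : 0 ≤ θ)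
    (hA : ∀ μ ∈ spectrum ℂ (A.map (algebraMap ℝ ℂ)), ‖μ‖ ≤ θ) {x : ℝ} (hx : θ < x) (m : ι → ℝ)
    (i : ι) : Summable fun n => (A ^ n *ᵥ m) i * (x⁻¹) ^ n := by
  obtain ⟨r, hθr, hrx⟩ := exists_between hx
  have hr0 : 0 ≤ r := hθ.trans hθr.le
  have hx0 : 0 < x := hθ.trans_lt hx
  have hradius : spectralRadius ℂ (A.map (algebraMap ℝ ℂ)) < ENNReal.ofReal r := by
    refine lt_of_le_of_lt (iSup₂_le fun μ hμ => ?_)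
      ((ENNReal.ofReal_lt_ofReal_iff (hθ.trans_lt hθr)).2 hθr)
    rw [← enorm_eq_nnnorm, ← ofReal_norm]
    exact ENNReal.ofReal_le_ofReal (hA μ hμ)
  refine Summable.of_norm_bounded_eventually_nat (g := fun n => (r / x) ^ n * ‖m‖)
    ((summable_geometric_of_lt_one (by positivity) ((div_lt_one hx0).2 hrx)).mul_right _) ?_
  filter_upwards [eventually_norm_pow_le hradius] with n hn
  have hnorm : ‖A ^ n‖ ≤ r ^ n := by
    rw [← Matrix.map_pow] at hn
    simpa only [linfty_opNorm_def, map_apply, nnnorm_algebraMap'] using hn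
  calc ‖(A ^ n *ᵥ m) i * x⁻¹ ^ n‖ = ‖(A ^ n *ᵥ m) i‖ * x⁻¹ ^ n := by
        rw [norm_mul, Real.norm_of_nonneg (by positivity : 0 ≤ x⁻¹ ^ n)]
    _ ≤ ‖A ^ n‖ * ‖m‖ * x⁻¹ ^ n := by
        gcongr; exact (norm_le_pi_norm _ i).trans (linfty_opNorm_mulVec _ _)
    _ ≤ r ^ n * ‖m‖ * x⁻¹ ^ n := by gcongr
    _ = (r / x) ^ n * ‖m‖ := by rw [div_eq_mul_inv, mul_pow]; ring

end Norm

theorem norm_pow_smul_le_pow_mulVec {A : Matrix ι ι ℝ} (hA : ∀ i j, 0 ≤ A i j) {μ : ℂ} {z : ι → ℂ}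
    (hz : A.map (algebraMap ℝ ℂ) *ᵥ z = μ • z) (n : ℕ) :
    ‖μ‖ ^ n • (fun i => ‖z i‖) ≤ A ^ n *ᵥ fun i => ‖z i‖ := by
  have hone : ‖μ‖ • (fun i => ‖z i‖) ≤ A *ᵥ fun i => ‖z i‖ := fun i => by
    calc ‖μ‖ * ‖z i‖ = ‖(A.map (algebraMap ℝ ℂ) *ᵥ z) i‖ := by rw [hz]; simp
      _ ≤ ∑ j, ‖(A.map (algebraMap ℝ ℂ)) i j * z j‖ := norm_sum_le _ _
      _ = (A *ᵥ fun i => ‖z i‖) i :=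
        Finset.sum_congr rfl fun j _ => by simp [abs_of_nonneg (hA i j)]
  induction n with
  | zero => simp
  | succ n ih =>
    calc ‖μ‖ ^ (n + 1) • (fun i => ‖z i‖) = ‖μ‖ ^ n • ‖μ‖ • (fun i => ‖z i‖) := by
          rw [smul_smul, pow_succ]
      _ ≤ ‖μ‖ ^ n • (A *ᵥ fun i => ‖z i‖) := smul_le_smul_of_nonneg_left hone (by positivity)
      _ = A *ᵥ (‖μ‖ ^ n • fun i => ‖z i‖) := (mulVec_smul _ _ _).symm
      _ ≤ A *ᵥ (A ^ n *ᵥ fun i => ‖z i‖) := mulVec_mono hA ih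
      _ = A ^ (n + 1) *ᵥ fun i => ‖z i‖ := by rw [mulVec_mulVec, pow_succ']

theorem exists_mul_norm_pow_le_sum_pow_mulVec {A : Matrix ι ι ℝ} (hA : ∀ i j, 0 ≤ A i j) {μ : ℂ}
    (hμ : μ ∈ spectrum ℂ (A.map (algebraMap ℝ ℂ))) {m : ι → ℝ} (hm : ∀ i, 0 < m i) :
    ∃ κ : ℝ, 0 < κ ∧ ∀ n : ℕ, κ * ‖μ‖ ^ n ≤ ∑ i, (A ^ n *ᵥ m) i := by
  obtain ⟨z, hz⟩ := (hasEigenvalue_toLin'_iff.2 hμ).exists_hasEigenvector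
  obtain ⟨κ, hκ, hκm⟩ := exists_smul_le_of_pos hm fun i => ‖z i‖
  obtain ⟨i₀, hi₀⟩ := Function.ne_iff.1 hz.2
  have hnorm : 0 < ∑ i, ‖z i‖ :=
    Finset.sum_pos' (fun i _ => norm_nonneg _) ⟨i₀, Finset.mem_univ _, norm_pos_iff.2 hi₀⟩
  refine ⟨κ * ∑ i, ‖z i‖, mul_pos hκ hnorm, fun n => ?_⟩
  have hpow : κ • ‖μ‖ ^ n • (fun i => ‖z i‖) ≤ A ^ n *ᵥ m :=
    calc κ • ‖μ‖ ^ n • (fun i => ‖z i‖) ≤ κ • (A ^ n *ᵥ fun i => ‖z i‖) :=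
          smul_le_smul_of_nonneg_left
            (norm_pow_smul_le_pow_mulVec hA (by simpa using hz.apply_eq_smul) n) hκ.le
      _ = A ^ n *ᵥ (κ • fun i => ‖z i‖) := (mulVec_smul _ _ _).symm
      _ ≤ A ^ n *ᵥ m := mulVec_mono (pow_apply_nonneg hA n) hκm
  calc κ * (∑ i, ‖z i‖) * ‖μ‖ ^ n = ∑ i, (κ • ‖μ‖ ^ n • fun i => ‖z i‖) i := by
        simp only [Pi.smul_apply, smul_eq_mul, ← Finset.mul_sum]; ring
    _ ≤ ∑ i, (A ^ n *ᵥ m) i := Finset.sum_le_sum fun i _ => hpow i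

/-- Cayley–Hamilton. -/
theorem satisfiesRecurrence_charpoly (A : Matrix ι ι ℝ) (m : ι → ℝ) :
    SatisfiesRecurrence (fun n => ∑ i, (A ^ n *ᵥ m) i) A.charpoly := by
  intro n
  have hCH : A.charpoly.sum (fun k a => a • A ^ (n + k)) = 0 := by
    have h := congrArg (A ^ n * ·) (aeval_self_charpoly A)
    simp only [aeval_def, eval₂_eq_sum, Polynomial.sum, mul_zero, Finset.mul_sum] at h
    rw [← h]
    refine Finset.sum_congr rfl fun k _ => ?_
    beta_reduce
    rw [pow_add, ← Algebra.smul_def, mul_smul_comm]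
  have h := congrArg (fun B => ∑ i, (B *ᵥ m) i) hCH
  simp only [Polynomial.sum, sum_mulVec, Finset.sum_apply, smul_mulVec, Pi.smul_apply,
    smul_eq_mul, zero_mulVec, Pi.zero_apply, Finset.sum_const_zero] at h
  rw [Polynomial.sum, ← h, Finset.sum_comm]
  simp only [Finset.mul_sum]

theorem exists_isPerronRoot_and_hasGrowth {A : Matrix ι ι ℝ} (hA : ∀ i j, 0 ≤ A i j)
    (hnil : ¬ IsNilpotent A) {m : ι → ℝ} (hm : ∀ i, 0 < m i) :
    ∃ θ : ℝ, IsPerronRoot A θ ∧ HasGrowth (fun n => ∑ i, (A ^ n *ᵥ m) i) θ := by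
  set B := A.map (algebraMap ℝ ℂ)
  have hBnil : ¬ IsNilpotent B :=
    mt (IsNilpotent.map_iff (f := (algebraMap ℝ ℂ).mapMatrix)
      (Matrix.map_injective (algebraMap ℝ ℂ).injective)).1 hnil
  obtain ⟨μ₀, hμ₀, hμ₀0⟩ := Set.not_subset.1 (mt isNilpotent_of_spectrum_subset_zero hBnil)
  obtain ⟨μ, hμ, hmax⟩ := Set.exists_max_image (spectrum ℂ B) norm (finite_spectrum B) ⟨μ₀, hμ₀⟩
  have hgrowth : HasGrowth (fun n => ∑ i, (A ^ n *ᵥ m) i) ‖μ‖ :=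
    { pos := (norm_pos_iff.2 hμ₀0).trans_le (hmax μ₀ hμ₀)
      nonneg := fun n => Finset.sum_nonneg fun i _ => Finset.sum_nonneg fun j _ =>
        mul_nonneg (pow_apply_nonneg hA n i j) (hm j).le
      summable := fun x hx => by
        simp only [Finset.sum_mul]
        exact summable_sum fun i _ => summable_pow_mulVec (norm_nonneg μ) hmax hx m i
      lower := by
        obtain ⟨κ, hκ, h⟩ := exists_mul_norm_pow_le_sum_pow_mulVec hA hμ hm
        exact ⟨κ, hκ, 0, fun n _ => h n⟩ }
  refine ⟨‖μ‖, ⟨?_, fun ν hν => hmax ν (hasEigenvalue_toLin'_iff.1 hν)⟩, hgrowth⟩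
  refine hasEigenvalue_toLin'_iff.2 (mem_spectrum_iff_isRoot_charpoly.2 ?_)
  exact hgrowth.eval_eq_zero (Eventually.of_forall fun x hx =>
    (satisfiesRecurrence_charpoly A m).aeval_mul_eq (K := ℝ) (hgrowth.pos.trans hx).ne'
      (hgrowth.hasSum_invSeries hx))

end Perron

section Determinant

open scoped Matrix

theorem det_mul_eq_of_mulVec_eq_const {R ι : Type*} [CommRing R] [Fintype ι] [DecidableEq ι]
    {M : Matrix ι ι R} {v : ι → R} {c : R} (h : M *ᵥ v = fun _ => c) (i : ι) :
    M.det * v i = c * ∑ j, M.adjugate i j := by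
  have hadj : M.det • v = M.adjugate *ᵥ fun _ => c := by
    rw [← h, Matrix.mulVec_mulVec, Matrix.adjugate_mul, Matrix.smul_mulVec, Matrix.one_mulVec]
  simpa [Matrix.mulVec, dotProduct, ← Finset.sum_mul, mul_comm c] using congrFun hadj i

/-- Far out on the real line the diagonal entries dominate their columns. -/
theorem det_ne_zero_of_degree_lt {ι : Type*} [Fintype ι] [DecidableEq ι] {M : Matrix ι ι ℝ[X]}
    (hdiag : ∀ j, M j j ≠ 0) (hdeg : ∀ i j, i ≠ j → (M i j).degree < (M j j).degree) :
    M.det ≠ 0 := by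
  have hdom : ∀ j, ∀ᶠ x : ℝ in Filter.atTop,
      ∑ i ∈ Finset.univ.erase j, ‖(M i j).eval x‖ < ‖(M j j).eval x‖ := by
    intro j
    have hlittle : (fun x : ℝ => ∑ i ∈ Finset.univ.erase j, ‖(M i j).eval x‖)
        =o[Filter.atTop] fun x => (M j j).eval x :=
      Asymptotics.IsLittleO.fun_sum fun i hi => (isLittleO_atTop_of_degree_lt _ _
        (hdeg i j (Finset.ne_of_mem_erase hi))).norm_left
    filter_upwards [hlittle.def (c := 1 / 2) (by norm_num),
      (M j j).eventually_atTop_not_isRoot (hdiag j)] with x hx hx0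
    have hx0 : 0 < ‖(M j j).eval x‖ := norm_pos_iff.2 hx0
    have := (le_abs_self _).trans hx
    linarith
  obtain ⟨x, hx⟩ := (Filter.eventually_all.2 hdom).exists
  intro hdet
  refine det_ne_zero_of_sum_col_lt_diag (A := M.map (evalRingHom x)) hx ?_
  rw [← RingHom.mapMatrix_apply, ← RingHom.map_det, hdet, map_zero]

end Determinant

variable {α : Type*} {ℓ s : ℕ}

/-! ### Occurrences and overlaps of words -/

section Occurrences

variable [DecidableEq α]

theorem occurrences_nil (r : List α) : occurrences [] r = 0 := rfl

theorem occurrences_cons (x : α) (w r : List α) :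
    occurrences (x :: w) r = (if r <+: x :: w then 1 else 0) + occurrences w r := by
  simp only [occurrences, Finset.card_filter, List.length_cons, Finset.sum_range_succ',
    List.drop_succ_cons, List.drop_zero, add_comm]

theorem occurrences_concat {r : List α} (hr : r ≠ []) (w : List α) (x : α) :
    occurrences (w ++ [x]) r = occurrences w r + if r <:+ w ++ [x] then 1 else 0 := by
  induction w with
  | nil =>
    have hsingle : r <+: [x] ↔ r <:+ [x] := by
      simp [List.prefix_cons_iff, List.suffix_cons_iff, hr]
    simp [occurrences_cons, occurrences_nil, hsingle]
  | cons y w ih =>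
    rw [List.cons_append, occurrences_cons, ih, occurrences_cons]
    simp only [← List.cons_append, List.prefix_concat_iff]
    simp only [List.cons_append, List.suffix_cons_iff]
    by_cases h : r = y :: (w ++ [x])
    · have hlong : ∀ v : List α, v.length ≤ w.length + 1 → ¬ r <+: v ∧ ¬ r <:+ v := fun v hv =>
        ⟨fun h' => absurd h'.length_le (by simp [h]; omega),
          fun h' => absurd h'.length_le (by simp [h]; omega)⟩
      rw [if_pos (Or.inl h), if_pos (Or.inl h), if_neg (hlong _ (by simp)).1,
        if_neg (hlong _ (by simp)).2]
      ring
    · simp only [h, false_or, add_assoc]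

theorem occurrences_eq_zero_iff {r : List α} (hr : r ≠ []) (w : List α) :
    occurrences w r = 0 ↔ ¬ r <:+: w := by
  induction w with
  | nil => simp [occurrences_nil, hr]
  | cons x w ih =>
    rw [occurrences_cons, List.infix_cons_iff, Nat.add_eq_zero_iff, ih]
    simp

end Occurrences

section Words

/-- All words of length `n`. -/
noncomputable def words (α : Type*) [Finite α] (n : ℕ) : Finset (List α) :=
  (List.finite_length_eq α n).toFinset

theorem mem_words [Finite α] {n : ℕ} {w : List α} : w ∈ words α n ↔ w.length = n := by
  simp [words]

variable {M : Type*} [AddCommMonoid M]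

section Finite

variable [Finite α]

theorem sum_words_zero (φ : List α → M) : ∑ w ∈ words α 0, φ w = φ [] := by
  rw [show words α 0 = {[]} by ext w; simp [mem_words], Finset.sum_singleton]

theorem sum_words_add (a b : ℕ) (φ : List α → M) :
    ∑ w ∈ words α (a + b), φ w = ∑ u ∈ words α a, ∑ v ∈ words α b, φ (u ++ v) := by
  rw [← Finset.sum_product']
  refine Finset.sum_nbij' (fun w => (w.take a, w.drop a)) (fun p => p.1 ++ p.2) ?_ ?_ ?_ ?_ ?_ <;>
    simp +contextual [mem_words]

theorem sum_words_append [DecidableEq α] (n : ℕ) (p : List α) (φ : List α → M) :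
    ∑ w ∈ words α n, φ (w ++ p) =
      ∑ w ∈ words α (n + p.length), if p <:+ w then φ w else 0 := by
  rw [sum_words_add]
  refine Finset.sum_congr rfl fun w _ => ?_
  rw [Finset.sum_eq_single p _ fun h => absurd (mem_words.2 rfl) h,
    if_pos (List.suffix_append w p)]
  refine fun v hv hvp => if_neg fun h => hvp ?_
  have hlen := mem_words.1 hv
  exact ((List.suffix_of_suffix_length_le h (List.suffix_append w v) hlen.ge).eq_of_length
    hlen.symm).symm

end Finite

variable [Fintype α]

theorem sum_words_one (φ : List α → M) : ∑ w ∈ words α 1, φ w = ∑ x, φ [x] := by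
  refine (Finset.sum_bij (fun x _ => [x]) (by simp [mem_words]) (by simp) ?_
    fun _ _ => rfl).symm
  intro w hw
  obtain ⟨x, rfl⟩ := List.length_eq_one_iff.1 (mem_words.1 hw)
  exact ⟨x, Finset.mem_univ x, rfl⟩

theorem sum_words_concat (n : ℕ) (φ : List α → M) :
    ∑ w ∈ words α (n + 1), φ w = ∑ w ∈ words α n, ∑ x, φ (w ++ [x]) := by
  simp only [sum_words_add, sum_words_one]

theorem sum_words_cons (n : ℕ) (φ : List α → M) :
    ∑ w ∈ words α (n + 1), φ w = ∑ x, ∑ w ∈ words α n, φ (x :: w) := by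
  simp only [add_comm n 1, sum_words_add, sum_words_one, List.singleton_append]

open Classical in
theorem Collections.sum_language (W : Collections α ℓ s) (n : ℕ) (φ : List α → M) :
    ∑ w : W.language n, φ w.1 = ∑ w ∈ words α n, if W.Allowed w then φ w else 0 := by
  rw [← Finset.sum_filter]
  exact (Finset.sum_subtype _ (fun w => by simp [mem_words, language]) φ).symm

end Words

section Overlaps

theorem take_drop_eq_take_iff {u v : List α} {k : ℕ} (hku : k ≤ u.length) (hkv : k ≤ v.length) :
    (u.drop (u.length - k)).take v.length = v.take k ↔ v.take k <:+ u := by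
  rw [List.suffix_iff_eq_drop, List.length_take, min_eq_left hkv,
    List.take_of_length_le (by simp; omega), eq_comm]

variable [DecidableEq α]

/-- The lengths `k` of the proper overlaps of `v` and `u`: the first `k` symbols of `v` are the
last `k` symbols of `u`, where `0 < k < |v|`. -/
def overlaps (v u : List α) : Finset ℕ :=
  {k ∈ Finset.Ioo 0 v.length | v.take k <:+ u}

theorem mem_overlaps {v u : List α} {k : ℕ} :
    k ∈ overlaps v u ↔ (0 < k ∧ k < v.length) ∧ v.take k <:+ u := by
  simp [overlaps]

theorem le_length_of_mem_overlaps {v u : List α} {k : ℕ} (hk : k ∈ overlaps v u) :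
    k ≤ u.length := by
  obtain ⟨⟨_, hkv⟩, hsuff⟩ := mem_overlaps.1 hk
  simpa [List.length_take, min_eq_left hkv.le] using hsuff.length_le

theorem lt_length_of_mem_overlaps {v u : List α} {k : ℕ} (hk : k ∈ overlaps v u)
    (h : u <:+: v → u = v) : k < u.length := by
  obtain ⟨⟨_, hkv⟩, hsuff⟩ := mem_overlaps.1 hk
  refine lt_of_le_of_ne (le_length_of_mem_overlaps hk) fun hku => ?_
  have htake : v.take k = u := hsuff.eq_of_length (by simp [hku ▸ hkv.le, hku])
  have huv := h (htake ▸ (List.take_prefix k v).isInfix)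
  exact hkv.ne (huv ▸ hku)

theorem X_mul_corrPoly (u v : List α) :
    X * corrPoly u v = ∑ k ∈ Finset.Ioc 0 u.length with
      (u.drop (u.length - k)).take v.length = v.take k, X ^ k := by
  rw [corrPoly, Finset.mul_sum, Finset.sum_filter]
  refine Finset.sum_nbij' (fun i => u.length - i) (fun k => u.length - k)
    (by grind) (by grind) (by grind) (by grind) fun i hi => ?_
  have hi := Finset.mem_range.1 hi
  rw [List.length_drop, Nat.sub_sub_self hi.le, mul_ite, mul_zero, ← pow_succ',
    show u.length - 1 - i + 1 = u.length - i by omega]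

theorem X_mul_corrPoly_of_not_infix {u v : List α} (h : ¬ v <:+: u) :
    X * corrPoly u v = ∑ k ∈ overlaps v u, X ^ k := by
  rw [X_mul_corrPoly]
  refine Finset.sum_congr (Finset.ext fun k => ?_) fun _ _ => rfl
  rw [Finset.mem_filter, Finset.mem_Ioc]
  refine ⟨fun ⟨⟨hk0, hku⟩, heq⟩ => ?_, fun hk => ?_⟩
  · have hkv : k < v.length := not_le.1 fun hvk => h <| by
      rw [List.take_of_length_le hvk] at heq
      exact heq ▸ (List.take_prefix _ _).isInfix.trans (List.drop_suffix _ _).isInfix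
    exact mem_overlaps.2 ⟨⟨hk0, hkv⟩, (take_drop_eq_take_iff hku hkv.le).1 heq⟩
  · have hku := le_length_of_mem_overlaps hk
    obtain ⟨⟨hk0, hkv⟩, hsuff⟩ := mem_overlaps.1 hk
    exact ⟨⟨hk0, hku⟩, (take_drop_eq_take_iff hku hkv.le).2 hsuff⟩

theorem X_mul_corrPoly_self {u : List α} (hu : u ≠ []) :
    X * corrPoly u u = ∑ k ∈ overlaps u u, X ^ k + X ^ u.length := by
  have hpos := List.length_pos_iff.2 hu
  rw [X_mul_corrPoly, Finset.filter_congr fun k hk => take_drop_eq_take_iff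
    (Finset.mem_Ioc.1 hk).2 (Finset.mem_Ioc.1 hk).2, ← Finset.Ioo_insert_right hpos,
    Finset.filter_insert, if_pos (by simp), Finset.sum_insert (by simp), add_comm, overlaps]

end Overlaps

section Blocks

theorem length_block (x : ℕ → α) (k n : ℕ) : (block x k n).length = n := by
  simp [block]

theorem block_add (x : ℕ → α) (k a b : ℕ) :
    block x k (a + b) = block x k a ++ block x (k + a) b := by
  simp [block, List.range_add, add_assoc, Function.comp_def]

theorem block_comp_add (x : ℕ → α) (c k n : ℕ) :
    block (fun t => x (c + t)) k n = block x (c + k) n := by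
  simp [block, add_assoc]

theorem block_infix (x : ℕ → α) (k n : ℕ) : block x k n <:+: block x 0 (k + n) := by
  rw [block_add, zero_add]
  exact (List.suffix_append _ _).isInfix

theorem eq_block_of_append_eq {x : ℕ → α} {k n : ℕ} {a b : List α} (h : a ++ b = block x k n) :
    a = block x k a.length ∧ b = block x (k + a.length) b.length := by
  obtain rfl : n = a.length + b.length := by
    rw [← List.length_append, h, length_block]
  rw [block_add] at h
  exact List.append_inj h (length_block _ _ _).symm

theorem block_prefix (x : ℕ → α) (k : ℕ) {m n : ℕ} (h : m ≤ n) :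
    block x k m <+: block x k n := by
  obtain ⟨c, rfl⟩ := Nat.exists_eq_add_of_le h
  exact block_add x k m c ▸ List.prefix_append _ _

theorem exists_seq_forall_block {P : List α → Prop} {u : List α} (hu : P u)
    (hP : ∀ v, P v → ∃ a, P (v ++ [a])) :
    ∃ x : ℕ → α, block x 0 u.length = u ∧ ∀ n, P (block x 0 (u.length + n)) := by
  have : Nonempty α := ⟨(hP u hu).choose⟩
  choose! next hnext using hP
  let v : ℕ → List α := fun n => (fun w => w ++ [next w])^[n] u
  have hv : ∀ n, v (n + 1) = v n ++ [next (v n)] := fun n => Function.iterate_succ_apply' _ _ _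
  let x : ℕ → α := fun t => if h : t < u.length then u[t] else next (v (t - u.length))
  have hxu : block x 0 u.length = u :=
    List.ext_getElem (length_block _ _ _) fun t _ ht => by simp [block, x, ht]
  have hxv : ∀ n, block x 0 (u.length + n) = v n := by
    intro n
    induction n with
    | zero => exact hxu
    | succ n ih => rw [← add_assoc, block_add, ih, hv]; simp [block, x]
  refine ⟨x, hxu, fun n => hxv n ▸ ?_⟩
  induction n with
  | zero => exact hu
  | succ n ih => exact hv n ▸ hnext _ ih

end Blocks

/-! ### Weights of words -/

namespace Collections

variable {W : Collections α ℓ s}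

/-- The factor contributed by one occurrence of a word: its multiplicity if it is a repeated
word, and `0` if it is forbidden. -/
def factor (W : Collections α ℓ s) : Fin ℓ ⊕ Fin s → ℝ :=
  Sum.elim (fun i => (W.mult i : ℝ)) 0

theorem factor_nonneg (W : Collections α ℓ s) (i : Fin ℓ ⊕ Fin s) : 0 ≤ W.factor i := by
  rcases i with _ | _ <;> simp [factor]

theorem IsReduced.eq_of_suffix (hred : W.IsReduced) {w : List α} {i j : Fin ℓ ⊕ Fin s}
    (hi : W.word i <:+ w) (hj : W.word j <:+ w) : i = j := by
  by_contra h
  rcases List.suffix_or_suffix_of_suffix hi hj with h' | h'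
  · exact hred i j h h'.isInfix
  · exact hred j i (Ne.symm h) h'.isInfix

theorem IsReduced.word_not_infix_take (hred : W.IsReduced) {i j : Fin ℓ ⊕ Fin s} {n : ℕ}
    (hn : n < (W.word i).length) : ¬ W.word j <:+: (W.word i).take n := by
  intro h
  obtain rfl : j = i := not_not.1 fun hji =>
    hred j i hji (h.trans (List.take_prefix n _).isInfix)
  have := h.length_le.trans (List.length_take_le n _)
  omega

theorem IsReduced.word_ne_nil (hred : W.IsReduced) (hp : 2 ≤ W.maxLength) (i : Fin ℓ ⊕ Fin s) :
    W.word i ≠ [] := by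
  intro hi
  obtain ⟨j, _, hj⟩ := (Finset.lt_sup_iff (s := Finset.univ)
    (f := fun i => (W.word i).length)).1 (show 1 < W.maxLength from hp)
  refine hred i j ?_ (hi ▸ List.nil_infix)
  rintro rfl
  simp [hi] at hj

section Weight

variable [DecidableEq α]

/-- The multiplicity of a word that need not be extendable: `0` if the word contains a forbidden
word, and the product of the multiplicities of the occurrences of repeated words otherwise. -/
noncomputable def weight (W : Collections α ℓ s) (w : List α) : ℝ :=
  ∏ i, W.factor i ^ occurrences w (W.word i)

theorem weight_nonneg (W : Collections α ℓ s) (w : List α) : 0 ≤ W.weight w :=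
  Finset.prod_nonneg fun i _ => pow_nonneg (W.factor_nonneg i) _

theorem weight_nil (W : Collections α ℓ s) : W.weight [] = 1 := by
  simp [weight, occurrences_nil]

theorem weight_concat (hred : W.IsReduced) (hne : ∀ i, W.word i ≠ []) (w : List α) (x : α) :
    W.weight (w ++ [x]) = W.weight w +
      ∑ i, (W.factor i - 1) * if W.word i <:+ w ++ [x] then W.weight w else 0 := by
  have hprod : W.weight (w ++ [x]) =
      W.weight w * ∏ i, W.factor i ^ (if W.word i <:+ w ++ [x] then 1 else 0) := by
    simp only [weight, ← Finset.prod_mul_distrib, occurrences_concat (hne _), pow_add]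
  rw [hprod]
  by_cases h : ∃ i, W.word i <:+ w ++ [x]
  · obtain ⟨i, hi⟩ := h
    have hj : ∀ j, j ≠ i → ¬ W.word j <:+ w ++ [x] :=
      fun j hji hj => hji (hred.eq_of_suffix hj hi)
    rw [Finset.prod_eq_single i (fun j _ hji => by simp [hj j hji]) (by simp),
      Finset.sum_eq_single i (fun j _ hji => by simp [hj j hji]) (by simp), if_pos hi, if_pos hi]
    ring
  · push Not at h
    simp [h]

theorem weight_append_take (hred : W.IsReduced) (hne : ∀ i, W.word i ≠ []) (w u : List α) {n : ℕ}
    (hn : n ≤ u.length) :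
    W.weight (w ++ u.take n) = W.weight w + ∑ k ∈ Finset.Ioc 0 n, ∑ i, (W.factor i - 1) *
      if W.word i <:+ w ++ u.take k then W.weight (w ++ u.take k).dropLast else 0 := by
  induction n with
  | zero => simp
  | succ n ih =>
    rw [Finset.sum_Ioc_succ_top (Nat.zero_le n), ← add_assoc, ← ih (Nat.le_of_succ_le hn),
      List.take_add_one, List.getElem?_eq_getElem hn, Option.toList_some, ← List.append_assoc,
      weight_concat hred hne, List.dropLast_concat]

end Weight

/-! ### Recurrences for the weighted numbers of words -/

section Recurrence

variable [DecidableEq α]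

/-- The total weight of the words of length `n`; unlike `count`, it does not require the words to
be extendable to sequences of the subshift. -/
noncomputable def totalWeight [Finite α] (W : Collections α ℓ s) (n : ℕ) : ℝ :=
  ∑ w ∈ words α n, W.weight w

/-- The total weight, not counting the last occurrence, of the words of length `n` that end with
a given word of the collection. -/
noncomputable def endingWeight [Finite α] (W : Collections α ℓ s) (i : Fin ℓ ⊕ Fin s) (n : ℕ) : ℝ :=
  ∑ w ∈ words α n, if W.word i <:+ w then W.weight w.dropLast else 0

section Finite

variable [Finite α]

theorem totalWeight_zero (W : Collections α ℓ s) : W.totalWeight 0 = 1 := by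
  rw [totalWeight, sum_words_zero, weight_nil]

theorem endingWeight_nonneg (W : Collections α ℓ s) (i : Fin ℓ ⊕ Fin s) (n : ℕ) :
    0 ≤ W.endingWeight i n :=
  Finset.sum_nonneg fun w _ => by split_ifs; exacts [W.weight_nonneg _, le_rfl]

theorem endingWeight_of_lt {i : Fin ℓ ⊕ Fin s} {n : ℕ} (h : n < (W.word i).length) :
    W.endingWeight i n = 0 := by
  refine Finset.sum_eq_zero fun w hw => if_neg fun h' => ?_
  rw [← mem_words.1 hw] at h
  exact h'.length_le.not_gt h

theorem sum_weight_dropLast_append_take (hred : W.IsReduced) {i j : Fin ℓ ⊕ Fin s} (n : ℕ) {k : ℕ}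
    (hk : k < (W.word i).length) :
    (∑ w ∈ words α n, if W.word j <:+ w ++ (W.word i).take k
      then W.weight (w ++ (W.word i).take k).dropLast else 0) =
      if (W.word i).take k <:+ W.word j then W.endingWeight j (n + k) else 0 := by
  rw [sum_words_append n _ fun w => if W.word j <:+ w then W.weight w.dropLast else 0,
    List.length_take, min_eq_left hk.le]
  split_ifs with h
  · refine Finset.sum_congr rfl fun w _ => ?_
    by_cases hj : W.word j <:+ w
    · rw [if_pos (h.trans hj)]
    · simp [hj]
  · refine Finset.sum_eq_zero fun w _ => ?_
    split_ifs with hi hj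
    · exact ((List.suffix_or_suffix_of_suffix hi hj).elim h fun h' =>
        hred.word_not_infix_take hk h'.isInfix).elim
    · rfl
    · rfl

theorem endingWeight_add (hred : W.IsReduced) (hne : ∀ i, W.word i ≠ []) (i : Fin ℓ ⊕ Fin s)
    (n : ℕ) : W.endingWeight i (n + (W.word i).length) = W.totalWeight n +
      ∑ j, (W.factor j - 1) * ∑ k ∈ overlaps (W.word i) (W.word j), W.endingWeight j (n + k) := by
  have hlen : (W.word i).length - 1 < (W.word i).length :=
    Nat.sub_one_lt (List.length_pos_iff.2 (hne i)).ne'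
  calc W.endingWeight i (n + (W.word i).length)
      = ∑ w ∈ words α n, W.weight (w ++ (W.word i).take ((W.word i).length - 1)) := by
        rw [endingWeight, ← sum_words_append n (W.word i) fun w => W.weight w.dropLast]
        simp only [List.dropLast_append_of_ne_nil (hne i), List.dropLast_eq_take]
    _ = W.totalWeight n + ∑ j, (W.factor j - 1) *
          ∑ k ∈ Finset.Ioc 0 ((W.word i).length - 1), ∑ w ∈ words α n,
            if W.word j <:+ w ++ (W.word i).take k
              then W.weight (w ++ (W.word i).take k).dropLast else 0 := by
        simp only [weight_append_take hred hne _ _ hlen.le, Finset.sum_add_distrib, totalWeight,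
          Finset.mul_sum]
        rw [Finset.sum_comm (s := words α n), Finset.sum_comm (t := Finset.Ioc 0 _)]
        simp only [Finset.sum_comm (s := words α n)]
    _ = W.totalWeight n + ∑ j, (W.factor j - 1) *
          ∑ k ∈ overlaps (W.word i) (W.word j), W.endingWeight j (n + k) := by
        have hIoc : Finset.Ioc 0 ((W.word i).length - 1) = Finset.Ioo 0 (W.word i).length := by
          ext k
          simp only [Finset.mem_Ioc, Finset.mem_Ioo]
          omega
        simp only [hIoc, overlaps, Finset.sum_filter]
        congr! 4 with j _ k hk
        exact sum_weight_dropLast_append_take hred n (Finset.mem_Ioo.1 hk).2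

end Finite

variable [Fintype α]

theorem endingWeight_succ_le (W : Collections α ℓ s) (i : Fin ℓ ⊕ Fin s) (n : ℕ) :
    W.endingWeight i (n + 1) ≤ Fintype.card α * W.totalWeight n := by
  calc W.endingWeight i (n + 1) ≤ ∑ w ∈ words α n, ∑ _x : α, W.weight w := by
        rw [endingWeight, sum_words_concat]
        refine Finset.sum_le_sum fun w _ => Finset.sum_le_sum fun x _ => ?_
        rw [List.dropLast_concat]
        split_ifs
        exacts [le_rfl, W.weight_nonneg _]
    _ = Fintype.card α * W.totalWeight n := by simp [totalWeight, Finset.mul_sum]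

theorem totalWeight_succ (hred : W.IsReduced) (hne : ∀ i, W.word i ≠ []) (n : ℕ) :
    W.totalWeight (n + 1) = Fintype.card α * W.totalWeight n +
      ∑ i, (W.factor i - 1) * W.endingWeight i (n + 1) := by
  simp only [totalWeight, endingWeight, sum_words_concat, weight_concat hred hne,
    Finset.sum_add_distrib, List.dropLast_concat, Finset.mul_sum]
  congr 1
  · simp
  · rw [Finset.sum_comm (s := Finset.univ)]
    exact Finset.sum_congr rfl fun w _ => Finset.sum_comm

end Recurrence

/-! ### The correlation matrix -/

/-- The coefficients of `z` in the diagonal matrix `D(z)`: `1 - 1 / m_i` for the repeated words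
and `-1` for the forbidden ones. -/
noncomputable def coef (W : Collections α ℓ s) : Fin ℓ ⊕ Fin s → ℝ :=
  Sum.elim (fun i => 1 - 1 / (W.mult i : ℝ)) fun _ => -1

/-- The diagonal coefficients `ε_ii`: `1` for the repeated words and `0` for the forbidden
ones. -/
def repIndicator : Fin ℓ ⊕ Fin s → ℝ := Sum.elim (fun _ => 1) fun _ => 0

/-- The multiplicity of a repeated word, and `1` for the forbidden words. -/
def scale (W : Collections α ℓ s) : Fin ℓ ⊕ Fin s → ℝ :=
  Sum.elim (fun i => (W.mult i : ℝ)) fun _ => 1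

theorem coef_mul_scale (hmult : ∀ i, W.mult i ≠ 0) (j : Fin ℓ ⊕ Fin s) :
    W.coef j * W.scale j = W.factor j - 1 := by
  rcases j with j | j
  · have : (W.mult j : ℝ) ≠ 0 := Nat.cast_ne_zero.2 (hmult j)
    simp only [coef, scale, factor, Sum.elim_inl]
    field_simp
  · simp [coef, scale, factor]

theorem repIndicator_mul_scale (W : Collections α ℓ s) (j : Fin ℓ ⊕ Fin s) :
    repIndicator j * W.scale j = W.factor j := by
  rcases j with _ | _ <;> simp [repIndicator, scale, factor]

theorem coef_sub_repIndicator_ne_zero (hmult : ∀ i, W.mult i ≠ 0) (j : Fin ℓ ⊕ Fin s) :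
    W.coef j - repIndicator j ≠ 0 := by
  rcases j with j | j
  · simp [coef, repIndicator, hmult j]
  · simp [coef, repIndicator]

theorem coef_ne_zero (hmult : ∀ i, W.mult i ≠ 1) (j : Fin ℓ ⊕ Fin s) : W.coef j ≠ 0 := by
  rcases j with j | j
  · simpa [coef, sub_ne_zero, eq_comm (a := (1 : ℝ))] using hmult j
  · simp [coef]

theorem combination_eq_sum [Fintype α] (W : Collections α ℓ s) (T : Fin ℓ ⊕ Fin s → RatFunc ℝ) :
    W.combination T = RatFunc.X - RatFunc.C (Fintype.card α : ℝ) +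
      ∑ i, RatFunc.X * RatFunc.C (W.coef i) * T i := by
  rw [combination, Fintype.sum_sum_type, Finset.mul_sum, Finset.mul_sum]
  simp only [coef, Sum.elim_inl, Sum.elim_inr, map_neg, map_one, mul_neg, mul_one, neg_mul,
    Finset.sum_neg_distrib, mul_assoc]
  ring

section CorrelationMatrix

variable [DecidableEq α]

/-- The matrix `P(z)` over the polynomials. -/
noncomputable def polyP (W : Collections α ℓ s) :
    Matrix (Fin ℓ ⊕ Fin s) (Fin ℓ ⊕ Fin s) ℝ[X] :=
  Matrix.of fun i j => X * C (W.coef j) * corrPoly (W.word j) (W.word i) -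
    if i = j then C (repIndicator j) * X ^ (W.word j).length else 0

theorem map_polyP (W : Collections α ℓ s) :
    W.polyP.map (algebraMap ℝ[X] (RatFunc ℝ)) = W.matrixP := by
  ext i j
  rcases i with i | i <;> rcases j with j | j <;>
    simp only [matrixP, polyP, coef, repIndicator, word, Matrix.map_apply, Matrix.of_apply,
      Matrix.fromBlocks_apply₁₁, Matrix.fromBlocks_apply₁₂, Matrix.fromBlocks_apply₂₁,
      Matrix.fromBlocks_apply₂₂, Sum.elim_inl, Sum.elim_inr, Sum.inl.injEq, Sum.inr.injEq,
      reduceCtorEq, if_false, sub_zero, C_0, zero_mul, ite_self, map_sub, map_mul,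
      RatFunc.algebraMap_X, RatFunc.algebraMap_C]
  · split_ifs <;> simp
  · simp
  · simp

theorem polyP_apply (hred : W.IsReduced) (hne : ∀ i, W.word i ≠ []) (i j : Fin ℓ ⊕ Fin s) :
    W.polyP i j = C (W.coef j) * ∑ k ∈ overlaps (W.word i) (W.word j), X ^ k +
      if i = j then C (W.coef j - repIndicator j) * X ^ (W.word j).length else 0 := by
  rw [polyP, Matrix.of_apply, mul_comm X, mul_assoc]
  split_ifs with hij
  · subst hij
    rw [X_mul_corrPoly_self (hne i), C_sub]
    ring
  · rw [X_mul_corrPoly_of_not_infix (hred i j hij), sub_zero, add_zero]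

theorem lt_length_of_mem_overlaps_word (hred : W.IsReduced) {i j : Fin ℓ ⊕ Fin s} {k : ℕ}
    (hk : k ∈ overlaps (W.word i) (W.word j)) : k < (W.word j).length :=
  lt_length_of_mem_overlaps hk fun hinf =>
    congrArg W.word (not_not.1 fun hji => hred j i hji hinf)

theorem degree_C_mul_sum_overlaps_lt (hred : W.IsReduced) (a : ℝ) (i j : Fin ℓ ⊕ Fin s) :
    (C a * ∑ k ∈ overlaps (W.word i) (W.word j), X ^ k).degree <
      ((W.word j).length : WithBot ℕ) := by
  rw [← smul_eq_C_mul]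
  refine (degree_smul_le _ _).trans_lt ((degree_sum_le _ _).trans_lt
    ((Finset.sup_lt_iff (WithBot.bot_lt_coe _)).2 fun k hk => ?_))
  rw [degree_X_pow]
  exact Nat.cast_lt.2 (lt_length_of_mem_overlaps_word hred hk)

theorem degree_polyP_self (hred : W.IsReduced) (hne : ∀ i, W.word i ≠ [])
    (hmult : ∀ i, W.mult i ≠ 0) (j : Fin ℓ ⊕ Fin s) :
    (W.polyP j j).degree = ((W.word j).length : WithBot ℕ) := by
  have hlead := degree_C_mul_X_pow (W.word j).length (coef_sub_repIndicator_ne_zero hmult j)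
  rw [polyP_apply hred hne, if_pos rfl, degree_add_eq_right_of_degree_lt, hlead]
  rw [hlead]
  exact degree_C_mul_sum_overlaps_lt hred _ j j

theorem det_polyP_ne_zero (hred : W.IsReduced) (hne : ∀ i, W.word i ≠ [])
    (hmult : ∀ i, W.mult i ≠ 0) : W.polyP.det ≠ 0 := by
  refine det_ne_zero_of_degree_lt (fun j h0 => ?_) fun i j hij => ?_
  · simpa [h0] using degree_polyP_self hred hne hmult j
  · rw [degree_polyP_self hred hne hmult, polyP_apply hred hne, if_neg hij, add_zero]
    exact degree_C_mul_sum_overlaps_lt hred _ i j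

end CorrelationMatrix

/-! ### The linear system for the generating functions -/

section GeneratingFunctions

open scoped Matrix

variable [DecidableEq α] {x : ℝ}

section Finite

variable [Finite α]

theorem summable_endingWeight (hx : 0 < x)
    (hs : Summable fun n => W.totalWeight n * (x⁻¹) ^ n) (i : Fin ℓ ⊕ Fin s) :
    Summable fun n => W.endingWeight i n * (x⁻¹) ^ n := by
  have := Fintype.ofFinite α
  rw [← summable_nat_add_iff 1]
  refine Summable.of_nonneg_of_le
    (fun n => mul_nonneg (W.endingWeight_nonneg i _) (by positivity)) (fun n => ?_)
    (hs.mul_left (Fintype.card α * x⁻¹))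
  calc W.endingWeight i (n + 1) * x⁻¹ ^ (n + 1)
      ≤ (Fintype.card α * W.totalWeight n) * x⁻¹ ^ (n + 1) :=
        mul_le_mul_of_nonneg_right (W.endingWeight_succ_le i n) (by positivity)
    _ = Fintype.card α * x⁻¹ * (W.totalWeight n * x⁻¹ ^ n) := by ring

theorem hasSum_endingWeight_add (hx : 0 < x)
    (hs : Summable fun n => W.totalWeight n * (x⁻¹) ^ n) {i : Fin ℓ ⊕ Fin s} {k : ℕ}
    (hk : k ≤ (W.word i).length) :
    HasSum (fun n => W.endingWeight i (n + k) * (x⁻¹) ^ n)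
      (x ^ k * invSeries (W.endingWeight i) x) := by
  have hzero : ∑ n ∈ Finset.range k, W.endingWeight i n * x ^ (k - n) = 0 :=
    Finset.sum_eq_zero fun n hn => by
      rw [endingWeight_of_lt ((Finset.mem_range.1 hn).trans_le hk), zero_mul]
  simpa only [hzero, sub_zero, invSeries] using
    hasSum_shift hx.ne' (summable_endingWeight hx hs i).hasSum k

theorem invSeries_endingWeight (hred : W.IsReduced) (hne : ∀ i, W.word i ≠ []) (hx : 0 < x)
    (hs : Summable fun n => W.totalWeight n * (x⁻¹) ^ n) (i : Fin ℓ ⊕ Fin s) :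
    x ^ (W.word i).length * invSeries (W.endingWeight i) x = invSeries W.totalWeight x +
      ∑ j, (W.factor j - 1) *
        ∑ k ∈ overlaps (W.word i) (W.word j), x ^ k * invSeries (W.endingWeight j) x := by
  have hrec := hs.hasSum.add (hasSum_sum fun j (_ : j ∈ Finset.univ) =>
    (hasSum_sum fun k hk => hasSum_endingWeight_add (i := j) hx hs
      (le_length_of_mem_overlaps (v := W.word i) hk)).mul_left (W.factor j - 1))
  refine (hasSum_endingWeight_add hx hs le_rfl).unique (hrec.congr_fun fun n => ?_)
  rw [endingWeight_add hred hne, add_mul, Finset.sum_mul]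
  simp only [mul_assoc, Finset.sum_mul]

theorem eval_polyP_mulVec (hred : W.IsReduced) (hne : ∀ i, W.word i ≠ [])
    (hmult : ∀ i, W.mult i ≠ 0) (hx : 0 < x)
    (hs : Summable fun n => W.totalWeight n * (x⁻¹) ^ n) :
    W.polyP.map (eval x) *ᵥ (fun j => W.scale j * invSeries (W.endingWeight j) x) =
      fun _ => -invSeries W.totalWeight x := by
  funext i
  have hterm : ∀ j, (W.polyP i j).eval x * (W.scale j * invSeries (W.endingWeight j) x) =
      (W.factor j - 1) *
          (∑ k ∈ overlaps (W.word i) (W.word j), x ^ k * invSeries (W.endingWeight j) x) -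
        if i = j then x ^ (W.word j).length * invSeries (W.endingWeight j) x else 0 := by
    intro j
    have hcoef := coef_mul_scale hmult j
    have hrep := W.repIndicator_mul_scale j
    rw [polyP_apply hred hne, ← Finset.sum_mul]
    set O := ∑ k ∈ overlaps (W.word i) (W.word j), x ^ k with hO
    set E := invSeries (W.endingWeight j) x
    split_ifs with hij
    · simp only [eval_add, eval_mul, eval_C, eval_X, eval_pow, eval_finsetSum, ← hO]
      linear_combination (O * E + x ^ (W.word j).length * E) * hcoef -
        x ^ (W.word j).length * E * hrep
    · simp only [eval_add, eval_mul, eval_C, eval_X, eval_pow, eval_zero, eval_finsetSum, ← hO]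
      linear_combination O * E * hcoef
  simp only [Matrix.mulVec, dotProduct, Matrix.map_apply, hterm, Finset.sum_sub_distrib,
    Finset.sum_ite_eq, Finset.mem_univ, if_true]
  linear_combination -invSeries_endingWeight hred hne hx hs i

end Finite

variable [Fintype α]

theorem invSeries_totalWeight (hred : W.IsReduced) (hne : ∀ i, W.word i ≠ []) (hx : 0 < x)
    (hs : Summable fun n => W.totalWeight n * (x⁻¹) ^ n) :
    (x - Fintype.card α) * invSeries W.totalWeight x -
      x * ∑ i, (W.factor i - 1) * invSeries (W.endingWeight i) x = x := by
  have hshift : HasSum (fun n => W.totalWeight (n + 1) * (x⁻¹) ^ n)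
      (x * invSeries W.totalWeight x - x) := by
    simpa [totalWeight_zero, invSeries] using hasSum_shift hx.ne' hs.hasSum 1
  have hrec : HasSum (fun n => W.totalWeight (n + 1) * (x⁻¹) ^ n)
      (Fintype.card α * invSeries W.totalWeight x +
        ∑ i, (W.factor i - 1) * (x ^ 1 * invSeries (W.endingWeight i) x)) := by
    refine ((hs.hasSum.mul_left _).add (hasSum_sum fun i _ => (hasSum_endingWeight_add hx hs
      (List.length_pos_iff.2 (hne i))).mul_left (W.factor i - 1))).congr_fun fun n => ?_
    rw [totalWeight_succ hred hne, add_mul, Finset.sum_mul]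
    simp only [mul_assoc]
  have heq := hshift.unique hrec
  simp only [pow_one, mul_left_comm _ x, ← Finset.mul_sum] at heq
  linear_combination heq

end GeneratingFunctions

/-! ### The combination of row sums -/

section Combination

open scoped Matrix

variable [DecidableEq α]

theorem matrixQ_inv_apply (hmult : ∀ i, W.mult i ≠ 1) (i j : Fin ℓ ⊕ Fin s) :
    RatFunc.X * RatFunc.C (W.coef i) * W.matrixQ⁻¹ i j =
      RatFunc.X * RatFunc.C (W.coef j) * W.matrixP⁻¹ j i := by
  set d : Fin ℓ ⊕ Fin s → RatFunc ℝ := fun i => RatFunc.X * RatFunc.C (W.coef i) with hd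
  have hD : W.matrixD = Matrix.diagonal d := by
    rw [matrixD]
    congr 1
    funext i
    rcases i with i | i <;> simp [hd, coef]
  have hd0 : ∀ i, d i ≠ 0 := fun i => mul_ne_zero RatFunc.X_ne_zero
    ((_root_.map_ne_zero _).2 (coef_ne_zero hmult i))
  have hdet : IsUnit W.matrixD.det := by
    rw [hD, Matrix.det_diagonal, isUnit_iff_ne_zero]
    exact Finset.prod_ne_zero_iff.2 fun i _ => hd0 i
  have hQ : W.matrixD * W.matrixQ⁻¹ = (W.matrixP⁻¹)ᵀ * W.matrixD := by
    rw [matrixQ, Matrix.mul_inv_rev, Matrix.mul_inv_rev, Matrix.nonsing_inv_nonsing_inv _ hdet,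
      Matrix.mul_nonsing_inv_cancel_left _ _ hdet, Matrix.transpose_nonsing_inv]
  have hQij := congrFun₂ hQ i j
  rwa [hD, Matrix.diagonal_mul, Matrix.mul_diagonal, Matrix.transpose_apply, mul_comm _ (d j)]
    at hQij

variable [Fintype α]

theorem combination_rowSumP_eq_rowSumQ (hmult : ∀ i, W.mult i ≠ 1) :
    W.combination W.rowSumP = W.combination W.rowSumQ := by
  simp only [combination_eq_sum, rowSumP, rowSumQ, Finset.mul_sum, matrixQ_inv_apply hmult]
  rw [Finset.sum_comm]

/-- The numerator of the combination of row sums over the denominator `det P(z)`. -/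
noncomputable def combPoly (W : Collections α ℓ s) : ℝ[X] :=
  (X - C (Fintype.card α : ℝ)) * W.polyP.det +
    ∑ i, X * C (W.coef i) * ∑ j, W.polyP.adjugate i j

theorem combination_rowSumP_mul_det (hdet : W.polyP.det ≠ 0) :
    W.combination W.rowSumP * algebraMap ℝ[X] (RatFunc ℝ) W.polyP.det =
      algebraMap ℝ[X] (RatFunc ℝ) W.combPoly := by
  have hP : (algebraMap ℝ[X] (RatFunc ℝ)).mapMatrix W.polyP = W.matrixP := W.map_polyP
  have hdetP : algebraMap ℝ[X] (RatFunc ℝ) W.polyP.det = W.matrixP.det := by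
    rw [← hP, RingHom.map_det]
  have hdetP0 : W.matrixP.det ≠ 0 := hdetP ▸ RatFunc.algebraMap_ne_zero hdet
  have hinv : ∀ i j, W.matrixP⁻¹ i j * W.matrixP.det =
      algebraMap ℝ[X] (RatFunc ℝ) (W.polyP.adjugate i j) := by
    intro i j
    rw [Matrix.inv_def, Matrix.smul_apply, Ring.inverse_eq_inv', smul_eq_mul, mul_right_comm,
      inv_mul_cancel₀ hdetP0, one_mul, ← hP, ← RingHom.map_adjugate, RingHom.mapMatrix_apply,
      Matrix.map_apply]
  simp only [combination_eq_sum, combPoly, rowSumP, map_add, map_mul, map_sub, map_sum,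
    RatFunc.algebraMap_X, RatFunc.algebraMap_C, hdetP, add_mul, Finset.sum_mul, mul_assoc,
    Finset.mul_sum, hinv]

theorem invSeries_mul_eval_combPoly (hred : W.IsReduced) (hne : ∀ i, W.word i ≠ [])
    (hmult : ∀ i, W.mult i ≠ 0) {x : ℝ} (hx : 0 < x)
    (hs : Summable fun n => W.totalWeight n * (x⁻¹) ^ n) :
    invSeries W.totalWeight x * W.combPoly.eval x = x * W.polyP.det.eval x := by
  set G := invSeries W.totalWeight x
  set T : Fin ℓ ⊕ Fin s → ℝ := fun j => W.scale j * invSeries (W.endingWeight j) x with hT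
  set M : Matrix (Fin ℓ ⊕ Fin s) (Fin ℓ ⊕ Fin s) ℝ := (evalRingHom x).mapMatrix W.polyP with hM
  have htotal : (x - Fintype.card α) * G - x * ∑ i, W.coef i * T i = x := by
    simpa only [hT, ← mul_assoc, coef_mul_scale hmult] using invSeries_totalWeight hred hne hx hs
  have hMT : M *ᵥ T = fun _ => -G := eval_polyP_mulVec hred hne hmult hx hs
  have hdet : W.polyP.det.eval x = M.det := RingHom.map_det (evalRingHom x) W.polyP
  have hadjugate : ∀ i j, (W.polyP.adjugate i j).eval x = M.adjugate i j := fun i j => by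
    rw [hM, ← RingHom.map_adjugate]; rfl
  have hsum : G * ∑ i, x * W.coef i * ∑ j, M.adjugate i j =
      -(x * M.det * ∑ i, W.coef i * T i) := by
    rw [Finset.mul_sum, Finset.mul_sum, ← Finset.sum_neg_distrib]
    exact Finset.sum_congr rfl fun i _ => by
      linear_combination x * W.coef i * det_mul_eq_of_mulVec_eq_const hMT i
  simp only [combPoly, eval_add, eval_mul, eval_sub, eval_X, eval_C, eval_finsetSum, hdet,
    hadjugate, mul_add, hsum]
  linear_combination M.det * htotal

theorem isGreatest_realZeros_combination (hred : W.IsReduced) (hne : ∀ i, W.word i ≠ [])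
    (hmult : ∀ i, W.mult i ≠ 0) {θ : ℝ} (hW : HasGrowth W.totalWeight θ) :
    IsGreatest (realZeros (W.combination W.rowSumP)) θ := by
  have hdet := det_polyP_ne_zero hred hne hmult
  refine hW.isGreatest_realZeros ?_
  filter_upwards [eventually_eval_ne_zero hdet] with x hx hθ
  have heval := eval_mul_eval₂_of_mul_eq (RingHom.id ℝ) (combination_rowSumP_mul_det hdet)
    (by rwa [eval₂_id])
  rw [eval₂_id, eval₂_id] at heval
  refine mul_right_cancel₀ hx ?_
  rw [mul_assoc, heval]
  exact invSeries_mul_eval_combPoly hred hne hmult (hW.pos.trans hθ) (hW.summable x hθ)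

end Combination

/-! ### Allowed words -/

section Allowed

/-- The word contains no forbidden word. -/
def Avoids (W : Collections α ℓ s) (w : List α) : Prop :=
  ∀ j, ¬ W.forb j <:+: w

theorem Avoids.of_infix {u w : List α} (h : W.Avoids w) (hu : u <:+: w) : W.Avoids u :=
  fun j hj => h j (hj.trans hu)

theorem length_word_le_maxLength (W : Collections α ℓ s) (i : Fin ℓ ⊕ Fin s) :
    (W.word i).length ≤ W.maxLength :=
  Finset.le_sup (f := fun i => (W.word i).length) (Finset.mem_univ i)

theorem Avoids.append_append {u e v : List α} (he : W.maxLength ≤ e.length + 1)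
    (hue : W.Avoids (u ++ e)) (hev : W.Avoids (e ++ v)) : W.Avoids (u ++ (e ++ v)) := by
  rintro j ⟨a, b, h⟩
  have hj : (W.forb j).length ≤ e.length + 1 :=
    (W.length_word_le_maxLength (Sum.inr j)).trans he
  rcases le_or_gt u.length a.length with hl | hl
  · rw [List.append_assoc] at h
    obtain ⟨c, rfl⟩ : u <+: a := List.prefix_of_prefix_length_le (l₃ := u ++ (e ++ v))
      (List.prefix_append _ _) (h ▸ List.prefix_append _ _) hl
    rw [List.append_assoc, List.append_cancel_left_eq] at h
    exact hev j ⟨c, b, by rw [List.append_assoc]; exact h⟩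
  · rw [← List.append_assoc u] at h
    have hpre : a ++ W.forb j <+: u ++ e := by
      refine List.prefix_of_prefix_length_le (l₃ := u ++ e ++ v) ⟨b, h⟩ (List.prefix_append _ _) ?_
      simp only [List.length_append]
      omega
    exact hue j ((List.suffix_append a _).isInfix.trans hpre.isInfix)

theorem mem_shift_iff {x : ℕ → α} : x ∈ W.shift ↔ ∀ n, W.Avoids (block x 0 n) := by
  constructor
  · rintro hx n j ⟨u, v, h⟩
    rw [List.append_assoc] at h
    exact hx j _ (eq_block_of_append_eq (eq_block_of_append_eq h).2).1.symm
  · intro h j k hjk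
    exact h _ j (hjk ▸ block_infix x k _)

theorem shift_comp_add {x : ℕ → α} (hx : x ∈ W.shift) (c : ℕ) :
    (fun t => x (c + t)) ∈ W.shift := fun j k => by
  rw [block_comp_add]
  exact hx j _

theorem allowed_iff {w : List α} : W.Allowed w ↔ ∃ x ∈ W.shift, block x 0 w.length = w := by
  constructor
  · rintro ⟨x, hx, k, h⟩
    exact ⟨_, shift_comp_add hx k, by rw [block_comp_add]; exact h⟩
  · rintro ⟨x, hx, h⟩
    exact ⟨x, hx, 0, h⟩

theorem allowed_block {x : ℕ → α} (hx : x ∈ W.shift) (k n : ℕ) : W.Allowed (block x k n) :=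
  ⟨x, hx, k, by rw [length_block]⟩

theorem allowed_nil (hshift : W.shift.Nonempty) : W.Allowed [] :=
  allowed_block hshift.some_mem 0 0

theorem Allowed.of_infix {u w : List α} (h : W.Allowed w) (hu : u <:+: w) : W.Allowed u := by
  obtain ⟨x, hx, k, hw⟩ := h
  obtain ⟨a, b, rfl⟩ := hu
  rw [List.append_assoc] at hw
  exact ⟨x, hx, _, (eq_block_of_append_eq (eq_block_of_append_eq hw.symm).2).1.symm⟩

theorem Allowed.avoids {w : List α} (h : W.Allowed w) : W.Avoids w := by
  obtain ⟨x, hx, hw⟩ := allowed_iff.1 h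
  exact hw ▸ mem_shift_iff.1 hx _

theorem Allowed.cons {a : α} {v w : List α} (hw : W.Allowed w) (hvw : v <+: w)
    (hv : W.Allowed (a :: v)) (hlen : W.maxLength ≤ v.length + 1) : W.Allowed (a :: w) := by
  obtain ⟨y, hy, hyw⟩ := allowed_iff.1 hw
  let z : ℕ → α := fun t => Nat.casesOn t a y
  have hzy : ∀ k n, block z (k + 1) n = block y k n := fun k n =>
    List.map_congr_left fun t _ => by rw [add_right_comm]
  have hzw : block z 0 (w.length + 1) = a :: w := by
    rw [add_comm, block_add, zero_add, ← zero_add 1, hzy, hyw]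
    rfl
  refine allowed_iff.2 ⟨z, fun j k hjk => ?_, hzw⟩
  cases k with
  | zero =>
    have hj : (W.forb j).length ≤ v.length + 1 :=
      (W.length_word_le_maxLength (Sum.inr j)).trans hlen
    have hjw : W.forb j <+: a :: w := by
      rw [← hjk, ← hzw]
      exact block_prefix z 0 (hj.trans (Nat.succ_le_succ hvw.length_le))
    exact hv.avoids j (List.prefix_of_prefix_length_le hjw
      ((List.prefix_cons_inj a).2 hvw) hj).isInfix
  | succ k => exact hy j k (by rw [← hzy]; exact hjk)

end Allowed

/-! ### Extendable words -/

section Extendable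

/-- Words with arbitrarily long extensions to the right that avoid the forbidden words. -/
def Extendable (W : Collections α ℓ s) (u : List α) : Prop :=
  ∀ n, ∃ v : List α, v.length = n ∧ W.Avoids (u ++ v)

theorem Extendable.avoids {u : List α} (h : W.Extendable u) : W.Avoids u := by
  obtain ⟨v, _, hv⟩ := h 0
  exact hv.of_infix (List.prefix_append _ _).isInfix

variable [Finite α]

theorem Extendable.exists_concat {u : List α} (h : W.Extendable u) :
    ∃ x, W.Extendable (u ++ [x]) := by
  by_contra! hx
  simp only [Extendable, not_forall] at hx
  choose n hn using hx
  obtain ⟨M, hM⟩ := (Set.finite_range n).bddAbove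
  obtain ⟨v, hv, hav⟩ := h (M + 1)
  cases v with
  | nil => simp at hv
  | cons x v =>
    have hnx : n x ≤ v.length := by
      have := hM (Set.mem_range_self x)
      simp only [List.length_cons] at hv
      omega
    refine hn x ⟨v.take (n x), by simp [hnx], hav.of_infix ?_⟩
    rw [List.append_assoc, List.singleton_append]
    exact ((List.prefix_append_right_inj u).2
      ((List.prefix_cons_inj x).2 (List.take_prefix _ _))).isInfix

theorem Extendable.allowed {u : List α} (h : W.Extendable u) : W.Allowed u := by
  obtain ⟨x, hxu, hx⟩ := exists_seq_forall_block h fun v hv => hv.exists_concat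
  refine allowed_iff.2 ⟨x, mem_shift_iff.2 fun n => (hx n).avoids.of_infix ?_, hxu⟩
  rw [add_comm, block_add]
  exact (List.prefix_append _ _).isInfix

theorem exists_extension_bound (W : Collections α ℓ s) :
    ∃ N : ℕ, ∀ u v : List α, W.maxLength ≤ u.length + 1 → v.length = N → W.Avoids (u ++ v) →
      W.Allowed u := by
  have hbound : ∀ e : List α, ∃ n, ¬ W.Extendable e → ∀ v : List α, v.length = n →
      ¬ W.Avoids (e ++ v) := by
    intro e
    by_cases he : W.Extendable e
    · exact ⟨0, fun h => absurd he h⟩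
    · simp only [Extendable, not_forall, not_exists, not_and] at he
      obtain ⟨n, hn⟩ := he
      exact ⟨n, fun _ => hn⟩
  choose n hn using hbound
  refine ⟨(words α (W.maxLength - 1)).sup n, fun u v hu hv huv => Extendable.allowed ?_⟩
  obtain ⟨a, e, rfl, he⟩ : ∃ a e : List α, a ++ e = u ∧ e.length = W.maxLength - 1 :=
    ⟨u.take (u.length - (W.maxLength - 1)), u.drop (u.length - (W.maxLength - 1)),
      List.take_append_drop _ _, by rw [List.length_drop]; omega⟩
  have hext : W.Extendable e := by
    by_contra hne
    have hle : n e ≤ v.length := hv ▸ Finset.le_sup (mem_words.2 he)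
    refine hn e hne (v.take (n e)) (by simp [hle]) (huv.of_infix ?_)
    rw [List.append_assoc]
    exact ((List.prefix_append_right_inj e).2 (List.take_prefix _ _)).isInfix.trans
      (List.suffix_append a _).isInfix
  intro m
  obtain ⟨v', hv', hav⟩ := hext m
  refine ⟨v', hv', ?_⟩
  rw [List.append_assoc]
  exact Avoids.append_append (by omega) (huv.of_infix (List.prefix_append _ _).isInfix) hav

end Extendable

/-! ### Weights of allowed words -/

section AllowedWeight

variable [DecidableEq α]

theorem weight_eq_zero_of_not_avoids (hne : ∀ i, W.word i ≠ []) {w : List α}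
    (h : ¬ W.Avoids w) : W.weight w = 0 := by
  simp only [Avoids, not_forall, not_not] at h
  obtain ⟨j, hj⟩ := h
  refine Finset.prod_eq_zero (Finset.mem_univ (Sum.inr j)) (zero_pow ?_)
  rw [Ne, occurrences_eq_zero_iff (hne _), not_not]
  exact hj

theorem weight_of_avoids (hne : ∀ i, W.word i ≠ []) {w : List α} (h : W.Avoids w) :
    W.weight w = ∏ i, (W.mult i : ℝ) ^ occurrences w (W.rep i) := by
  have hforb : ∀ j : Fin s, W.factor (Sum.inr j) ^ occurrences w (W.word (Sum.inr j)) = 1 :=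
    fun j => by rw [(occurrences_eq_zero_iff (hne (Sum.inr j)) w).2 (h j), pow_zero]
  rw [weight, Fintype.prod_sum_type, Finset.prod_eq_one fun j _ => hforb j, mul_one]
  rfl

theorem weight_pos (hne : ∀ i, W.word i ≠ []) (hmult : ∀ i, W.mult i ≠ 0) {w : List α}
    (h : W.Avoids w) : 0 < W.weight w := by
  rw [weight_of_avoids hne h]
  exact Finset.prod_pos fun i _ => pow_pos (Nat.cast_pos.2 (Nat.pos_of_ne_zero (hmult i))) _

theorem cast_multiplicity (hne : ∀ i, W.word i ≠ []) {w : List α} (h : W.Allowed w) :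
    (W.multiplicity w : ℝ) = W.weight w := by
  simp only [multiplicity, if_pos h, weight_of_avoids hne h.avoids, Nat.cast_prod, Nat.cast_pow]

theorem multiplicity_of_not_allowed {w : List α} (h : ¬ W.Allowed w) : W.multiplicity w = 0 :=
  if_neg h

theorem weight_cons (W : Collections α ℓ s) (a : α) (w : List α) :
    W.weight (a :: w) =
      (∏ i, W.factor i ^ (if W.word i <+: a :: w then 1 else 0)) * W.weight w := by
  simp only [weight, ← Finset.prod_mul_distrib, occurrences_cons, pow_add]

theorem weight_concat_le (hred : W.IsReduced) (hne : ∀ i, W.word i ≠ []) (w : List α) (x : α) :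
    W.weight (w ++ [x]) ≤ (1 + ∑ i, W.factor i) * W.weight w := by
  rw [weight_concat hred hne, add_mul, one_mul, Finset.sum_mul]
  refine add_le_add le_rfl (Finset.sum_le_sum fun i _ => ?_)
  have hw := W.weight_nonneg w
  split_ifs
  · exact mul_le_mul_of_nonneg_right (sub_le_self _ zero_le_one) hw
  · exact (mul_zero _).trans_le (mul_nonneg (W.factor_nonneg i) hw)

theorem weight_append_le (hred : W.IsReduced) (hne : ∀ i, W.word i ≠ []) (w v : List α) :
    W.weight (w ++ v) ≤ (1 + ∑ i, W.factor i) ^ v.length * W.weight w := by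
  induction v using List.reverseRecOn with
  | nil => simp
  | append_singleton v x ih =>
    have hpos : 0 ≤ 1 + ∑ i, W.factor i :=
      add_nonneg zero_le_one (Finset.sum_nonneg fun i _ => W.factor_nonneg i)
    rw [← List.append_assoc, List.length_append, List.length_singleton, pow_succ', mul_assoc]
    exact (weight_concat_le hred hne _ x).trans (mul_le_mul_of_nonneg_left ih hpos)

theorem ratio_mul_multiplicity (hne : ∀ i, W.word i ≠ []) (hmult : ∀ i, W.mult i ≠ 0) {a : α}
    {v w : List α} (hvw : v <+: w) (hlen : W.maxLength ≤ v.length + 1) (h : W.Allowed (a :: w)) :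
    W.ratio (a :: v) * W.multiplicity w = W.multiplicity (a :: w) := by
  have hav : W.Allowed (a :: v) := h.of_infix ((List.prefix_cons_inj a).2 hvw).isInfix
  have hw : W.Allowed w := h.of_infix (List.suffix_cons a w).isInfix
  have hv : W.Allowed v := hw.of_infix hvw.isInfix
  have hprefix : ∀ i, W.word i <+: a :: w ↔ W.word i <+: a :: v := fun i =>
    ⟨fun hi => List.prefix_of_prefix_length_le hi ((List.prefix_cons_inj a).2 hvw)
      ((W.length_word_le_maxLength i).trans hlen),
      fun hi => hi.trans ((List.prefix_cons_inj a).2 hvw)⟩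
  rw [ratio, List.tail_cons, cast_multiplicity hne hav, cast_multiplicity hne hv,
    cast_multiplicity hne hw, cast_multiplicity hne h, weight_cons, weight_cons, mul_div_assoc,
    div_self (weight_pos hne hmult hv.avoids).ne', mul_one]
  simp only [hprefix]

end AllowedWeight

/-! ### The transfer matrix -/

section TransferMatrix

open scoped Matrix

theorem starDefined_cons_iff {a : α} {u v w : List α} (hvw : v <+: w)
    (hlen : v.length = u.length + 1) : StarDefined (a :: u) v ↔ u <+: w := by
  have hdrop : v.dropLast <+: w := (List.dropLast_prefix v).trans hvw
  rw [StarDefined, List.tail_cons]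
  refine ⟨fun h => h ▸ hdrop, fun h => ?_⟩
  have hle : u.length = v.dropLast.length := by rw [List.length_dropLast, hlen]; rfl
  exact (List.prefix_of_prefix_length_le h hdrop hle.le).eq_of_length hle

theorem wordStar_cons_of_starDefined {a : α} {u v : List α} (hv : v ≠ [])
    (h : StarDefined (a :: u) v) : wordStar (a :: u) v = a :: v := by
  rw [StarDefined, List.tail_cons] at h
  rw [wordStar, List.getLast?_eq_getLast_of_ne_nil hv, Option.toList_some, List.cons_append, h,
    List.dropLast_append_getLast hv]

theorem sum_language_ite_prefix [Fintype α] [DecidableEq α] {M : Type*} [AddCommMonoid M] {k : ℕ}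
    {w : List α} (h : W.Allowed w) (hk : k ≤ w.length) (φ : W.language k → M) :
    (∑ v : W.language k, if v.1 <+: w then φ v else 0) =
      φ ⟨w.take k, List.length_take_of_le hk, h.of_infix (List.take_prefix k w).isInfix⟩ := by
  refine (Finset.sum_eq_single (⟨w.take k, _⟩ : W.language k) (fun v _ hv => ?_) (by simp)).trans
    (if_pos (List.take_prefix k w))
  refine if_neg fun h' => hv (Subtype.ext ?_)
  rw [List.prefix_iff_eq_take.1 h', v.2.1]

variable [DecidableEq α]

theorem adjMatrix_mul_multiplicity (hne : ∀ i, W.word i ≠ []) (hmult : ∀ i, W.mult i ≠ 0)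
    (hp : 2 ≤ W.maxLength) {a : α} {u w : List α} {U V : W.language (W.maxLength - 1)}
    (hU : U.1 = a :: u) (hw : W.Allowed w) (hVw : V.1 <+: w) :
    W.adjMatrix U V * W.multiplicity w =
      if u <+: w then (W.multiplicity (a :: w) : ℝ) else 0 := by
  have hlenV : V.1.length + 1 = W.maxLength := by rw [V.2.1]; omega
  have hlenU : V.1.length = u.length + 1 := by rw [V.2.1, ← U.2.1, hU, List.length_cons]
  rw [adjMatrix, Matrix.of_apply, hU, starDefined_cons_iff hVw hlenU]
  by_cases hu : u <+: w
  · rw [wordStar_cons_of_starDefined (List.ne_nil_of_length_eq_add_one hlenU)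
      ((starDefined_cons_iff hVw hlenU).2 hu)]
    by_cases haw : W.Allowed (a :: w)
    · have haV : a :: V.1 ∈ W.language W.maxLength :=
        ⟨hlenV, haw.of_infix ((List.prefix_cons_inj a).2 hVw).isInfix⟩
      rw [if_pos ⟨hu, haV⟩, if_pos hu, ratio_mul_multiplicity hne hmult hVw hlenV.ge haw]
    · have haV : a :: V.1 ∉ W.language W.maxLength := fun h =>
        haw (hw.cons hVw h.2 hlenV.ge)
      rw [if_neg fun h => haV h.2, zero_mul, multiplicity_of_not_allowed haw, Nat.cast_zero,
        ite_self]
  · rw [if_neg fun h => hu h.1, if_neg hu, zero_mul]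

/-- The number of allowed words of length `n` with prefix `u`, counted with multiplicity. -/
noncomputable def prefixCount [Finite α] (W : Collections α ℓ s) (n : ℕ) (u : List α) : ℝ :=
  ∑ w ∈ words α n, if u <+: w then (W.multiplicity w : ℝ) else 0

theorem prefixCount_length [Finite α] (W : Collections α ℓ s) (u : List α) :
    W.prefixCount u.length u = W.multiplicity u := by
  rw [prefixCount, Finset.sum_eq_single u, if_pos List.prefix_rfl]
  · exact fun w hw hwu => if_neg fun h => hwu (h.eq_of_length (mem_words.1 hw).symm).symm
  · exact fun h => absurd (mem_words.2 rfl) h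

theorem prefixCount_succ_cons [Finite α] (W : Collections α ℓ s) (n : ℕ) (a : α) (u : List α) :
    W.prefixCount (n + 1) (a :: u) =
      ∑ w ∈ words α n, if u <+: w then (W.multiplicity (a :: w) : ℝ) else 0 := by
  have := Fintype.ofFinite α
  rw [prefixCount, sum_words_cons, Finset.sum_eq_single a]
  · simp only [List.prefix_cons_inj]
  · exact fun b _ hb => Finset.sum_eq_zero fun w _ =>
      if_neg fun h => hb (List.cons_prefix_cons.1 h).1.symm
  · simp

variable [Fintype α]

theorem prefixCount_succ (hne : ∀ i, W.word i ≠ []) (hmult : ∀ i, W.mult i ≠ 0)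
    (hp : 2 ≤ W.maxLength) {n : ℕ} (hn : W.maxLength - 1 ≤ n)
    (U : W.language (W.maxLength - 1)) :
    W.prefixCount (n + 1) U.1 = ∑ V, W.adjMatrix U V * W.prefixCount n V.1 := by
  obtain ⟨a, u, hU⟩ : ∃ a u, U.1 = a :: u := List.exists_cons_of_length_pos (by rw [U.2.1]; omega)
  rw [hU, prefixCount_succ_cons]
  simp only [prefixCount, Finset.mul_sum, mul_ite, mul_zero]
  rw [Finset.sum_comm]
  refine Finset.sum_congr rfl fun w hw => ?_
  by_cases h : W.Allowed w
  · rw [sum_language_ite_prefix h (hn.trans_eq (mem_words.1 hw).symm),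
      adjMatrix_mul_multiplicity hne hmult hp hU h (List.take_prefix _ _)]
  · have haw : ¬ W.Allowed (a :: w) := fun h' => h (h'.of_infix (List.suffix_cons a w).isInfix)
    simp [multiplicity_of_not_allowed h, multiplicity_of_not_allowed haw]

theorem prefixCount_eq_pow_mulVec (hne : ∀ i, W.word i ≠ []) (hmult : ∀ i, W.mult i ≠ 0)
    (hp : 2 ≤ W.maxLength) (n : ℕ) :
    (fun V : W.language (W.maxLength - 1) => W.prefixCount (n + (W.maxLength - 1)) V.1) =
      W.adjMatrix ^ n *ᵥ fun V => (W.multiplicity V.1 : ℝ) := by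
  induction n with
  | zero =>
    funext V
    rw [pow_zero, Matrix.one_mulVec, zero_add, ← prefixCount_length, V.2.1]
  | succ n ih =>
    rw [pow_succ', ← Matrix.mulVec_mulVec, ← ih]
    funext V
    rw [add_right_comm, prefixCount_succ hne hmult hp (Nat.le_add_left _ _)]
    rfl

theorem count_eq_sum_words (hnil : W.Allowed []) (n : ℕ) :
    W.count n = ∑ w ∈ words α n, W.multiplicity w := by
  classical
  rw [count]
  split_ifs with hn
  · subst hn
    simp [sum_words_zero, multiplicity, hnil, occurrences_nil]
  · rw [W.sum_language]
    exact Finset.sum_congr rfl fun w _ => by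
      split_ifs with h; exacts [rfl, (multiplicity_of_not_allowed h).symm]

theorem sum_prefixCount (hnil : W.Allowed []) {n k : ℕ} (hk : k ≤ n) :
    ∑ V : W.language k, W.prefixCount n V.1 = W.count n := by
  simp only [prefixCount, count_eq_sum_words hnil, Nat.cast_sum]
  rw [Finset.sum_comm]
  refine Finset.sum_congr rfl fun w hw => ?_
  by_cases h : W.Allowed w
  · rw [sum_language_ite_prefix h (hk.trans_eq (mem_words.1 hw).symm)]
  · simp [multiplicity_of_not_allowed h]

theorem count_add (hne : ∀ i, W.word i ≠ []) (hmult : ∀ i, W.mult i ≠ 0) (hp : 2 ≤ W.maxLength)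
    (hnil : W.Allowed []) (n : ℕ) :
    (W.count (n + (W.maxLength - 1)) : ℝ) =
      ∑ V, (W.adjMatrix ^ n *ᵥ fun V => (W.multiplicity V.1 : ℝ)) V := by
  rw [← prefixCount_eq_pow_mulVec hne hmult hp, sum_prefixCount hnil (Nat.le_add_left _ _)]

end TransferMatrix

/-! ### Growth of the numbers of words -/

section Growth

variable [DecidableEq α]

theorem adjMatrix_nonneg (W : Collections α ℓ s) (U V : W.language (W.maxLength - 1)) :
    0 ≤ W.adjMatrix U V := by
  rw [adjMatrix, Matrix.of_apply]
  split_ifs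
  exacts [div_nonneg (Nat.cast_nonneg _) (Nat.cast_nonneg _), le_rfl]

theorem multiplicity_pos (hmult : ∀ i, W.mult i ≠ 0) {w : List α} (h : W.Allowed w) :
    0 < W.multiplicity w := by
  rw [multiplicity, if_pos h]
  exact Finset.prod_pos fun i _ => pow_pos (Nat.pos_of_ne_zero (hmult i)) _

variable [Fintype α]

theorem count_pos (hshift : W.shift.Nonempty) (hmult : ∀ i, W.mult i ≠ 0) (n : ℕ) :
    0 < W.count n := by
  obtain ⟨x, hx⟩ := hshift
  rw [count_eq_sum_words (allowed_nil ⟨x, hx⟩)]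
  exact Finset.sum_pos' (fun w _ => Nat.zero_le _)
    ⟨block x 0 n, mem_words.2 (length_block x 0 n), multiplicity_pos hmult (allowed_block hx 0 n)⟩

theorem not_isNilpotent_adjMatrix (hshift : W.shift.Nonempty) (hne : ∀ i, W.word i ≠ [])
    (hmult : ∀ i, W.mult i ≠ 0) (hp : 2 ≤ W.maxLength) : ¬ IsNilpotent W.adjMatrix := by
  rintro ⟨n, hn⟩
  have hzero := count_add hne hmult hp (allowed_nil hshift) n
  rw [hn] at hzero
  simp only [Matrix.zero_mulVec, Pi.zero_apply, Finset.sum_const_zero, Nat.cast_eq_zero] at hzero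
  exact (count_pos hshift hmult _).ne' hzero

theorem exists_isPerronRoot_and_hasGrowth_count (hshift : W.shift.Nonempty)
    (hne : ∀ i, W.word i ≠ []) (hmult : ∀ i, W.mult i ≠ 0) (hp : 2 ≤ W.maxLength) :
    ∃ θ, IsPerronRoot W.adjMatrix θ ∧ HasGrowth (fun n => (W.count n : ℝ)) θ := by
  obtain ⟨θ, hθ, hgrowth⟩ := exists_isPerronRoot_and_hasGrowth W.adjMatrix_nonneg
    (not_isNilpotent_adjMatrix hshift hne hmult hp)
    fun V => Nat.cast_pos.2 (multiplicity_pos hmult V.2.2)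
  simp only [← count_add hne hmult hp (allowed_nil hshift)] at hgrowth
  exact ⟨θ, hθ, .of_shift (fun n => Nat.cast_nonneg _) hgrowth⟩

theorem count_le_totalWeight (hne : ∀ i, W.word i ≠ []) (hnil : W.Allowed []) (n : ℕ) :
    (W.count n : ℝ) ≤ W.totalWeight n := by
  rw [count_eq_sum_words hnil, Nat.cast_sum]
  refine Finset.sum_le_sum fun w _ => ?_
  by_cases h : W.Allowed w
  · rw [cast_multiplicity hne h]
  · rw [multiplicity_of_not_allowed h, Nat.cast_zero]
    exact W.weight_nonneg w

theorem exists_totalWeight_le (hred : W.IsReduced) (hne : ∀ i, W.word i ≠ [])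
    (hnil : W.Allowed []) :
    ∃ (N : ℕ) (K : ℝ), ∀ n, W.maxLength - 1 ≤ n → W.totalWeight (n + N) ≤ K * W.count n := by
  obtain ⟨N, hN⟩ := W.exists_extension_bound
  refine ⟨N, (words α N).card * (1 + ∑ i, W.factor i) ^ N, fun n hn => ?_⟩
  rw [totalWeight, sum_words_add, count_eq_sum_words hnil, Nat.cast_sum, Finset.mul_sum]
  refine Finset.sum_le_sum fun u hu => ?_
  have hu := mem_words.1 hu
  by_cases h : W.Allowed u
  · rw [cast_multiplicity hne h, mul_assoc, ← nsmul_eq_mul, ← Finset.sum_const]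
    refine Finset.sum_le_sum fun v hv => ?_
    rw [← mem_words.1 hv]
    exact weight_append_le hred hne u v
  · rw [multiplicity_of_not_allowed h, Nat.cast_zero, mul_zero]
    refine (Finset.sum_eq_zero fun v hv => weight_eq_zero_of_not_avoids hne fun hav => h ?_).le
    exact hN u v (by omega) (mem_words.1 hv) hav

theorem hasGrowth_totalWeight (hred : W.IsReduced) (hne : ∀ i, W.word i ≠ [])
    (hnil : W.Allowed []) {θ : ℝ} (h : HasGrowth (fun n => (W.count n : ℝ)) θ) :
    HasGrowth W.totalWeight θ := by
  obtain ⟨N, K, hK⟩ := exists_totalWeight_le hred hne hnil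
  exact h.of_le_of_shift_le (count_le_totalWeight hne hnil) hK

theorem satisfiesRecurrence_count (hne : ∀ i, W.word i ≠ []) (hmult : ∀ i, W.mult i ≠ 0)
    (hp : 2 ≤ W.maxLength) (hnil : W.Allowed []) :
    SatisfiesRecurrence (fun n => (W.count n : ℝ))
      (W.adjMatrix.charpoly * X ^ (W.maxLength - 1)) := by
  refine SatisfiesRecurrence.mul_X_pow ?_
  simp only [count_add hne hmult hp hnil]
  exact satisfiesRecurrence_charpoly _ _

end Growth

end Collections

end RepeatedWords

theorem mainTheorem7_general {α : Type*} [Fintype α] [DecidableEq α] {ℓ s : ℕ}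
    (W : Collections α ℓ s) (hshift : W.shift.Nonempty) (hmult : ∀ i, 2 ≤ W.mult i)
    (hred : W.IsReduced) (hp : 2 ≤ W.maxLength) :
    W.combination W.rowSumP = W.combination W.rowSumQ ∧
    ∃ θ : ℝ, IsPerronRoot W.adjMatrix θ ∧
      IsGreatest (realZeros (W.combination W.rowSumP)) θ ∧
      IsGreatest (realZeros (W.combination W.rowSumQ)) θ ∧
      ∃ F : RatFunc ℝ, IsGeneratingFunction W.count F ∧ IsGreatest (realPoles F) θ := by
  have hne := hred.word_ne_nil hp
  have hmult0 : ∀ i, W.mult i ≠ 0 := fun i => by have := hmult i; omega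
  have hcombination : W.combination W.rowSumP = W.combination W.rowSumQ :=
    W.combination_rowSumP_eq_rowSumQ fun i => by have := hmult i; omega
  obtain ⟨θ, hperron, hgrowth⟩ := W.exists_isPerronRoot_and_hasGrowth_count hshift hne hmult0 hp
  have hzeros := W.isGreatest_realZeros_combination hred hne hmult0
    (W.hasGrowth_totalWeight hred hne (W.allowed_nil hshift) hgrowth)
  have hrec := W.satisfiesRecurrence_count hne hmult0 hp (W.allowed_nil hshift)
  have hrec0 :=
    (W.adjMatrix.charpoly_monic.mul (Polynomial.monic_X_pow (W.maxLength - 1))).ne_zero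
  exact ⟨hcombination, θ, hperron, hzeros, hcombination ▸ hzeros, _,
    hrec.isGeneratingFunction hrec0 hgrowth, hrec.isGreatest_realPoles hrec0 hgrowth⟩

theorem mainTheorem7 {α : Type*} [Fintype α] [DecidableEq α] {ℓ s : ℕ}
    (W : Collections α ℓ s)
    (hq : 2 ≤ Fintype.card α)
    (hforb : ∀ j, 2 ≤ (W.forb j).length)
    (hsymb : ∀ x : α, W.Allowed [x])
    (hrep : ∀ i, W.Allowed (W.rep i))
    (hmult : ∀ i, 2 ≤ W.mult i)
    (hred : W.IsReduced)
    (hp : 2 ≤ W.maxLength)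
    (hirr : W.adjMatrix.IsIrreducible) :
    W.combination W.rowSumP = W.combination W.rowSumQ ∧
    ∃ θ : ℝ, IsPerronRoot W.adjMatrix θ ∧
      IsGreatest (realZeros (W.combination W.rowSumP)) θ ∧
      IsGreatest (realZeros (W.combination W.rowSumQ)) θ ∧
      ∃ F : RatFunc ℝ, IsGeneratingFunction W.count F ∧ IsGreatest (realPoles F) θ := by
  obtain ⟨x, hx, -⟩ := hsymb (Fintype.card_pos_iff.1 (by omega)).some
  exact mainTheorem7_general W ⟨x, hx⟩ hmult hred hp
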